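/- \textbf{Setting.} Let $\mathcal X\subset\mathbb R^d$ be nonempty, closed and convex with $\|x-y\|\le D$ for all $x,y\in\mathcal X$ ($D>0$). Let $f_1,\dots,f_T:\mathcal X\to\mathbb R$ be convex and differentiable with $\|\nabla f_t(x)\|\le G$ for all $x\in\mathcal X$, $t\le T$ ($G>0$). An online algorithm plays $x_t$ before seeing $f_t$; its regret is $R_T=\sum_{t=1}^Tf_t(x_t)-\min_{x\in\mathcal X}\sum_{t=1}^Tf_t(x)$. A function $f$ is $\alpha$-exp-concave if $e^{-\alpha f}$ is concave on $\mathcal X$. The sequence $(f_1,\dots,f_T)$ is $k$-contaminated $\alpha$-exp-concave if there is $I\subset\{1,\dots,T\}$ with $|I|=k$ such that $f_t$ is $\alpha$-exp-concave for every $t\notin I$. \textbf{Algorithms.} Fix $x_1\in\mathcal X$ (the origin, if it lies in $\mathcal X$). For positive definite $A$ let $\Pi^A(y)=\arg\min_{x\in\mathcal X}(y-x)^\top A(y-x)$ and $\Pi=\Pi^{I}$. Let $m=\lceil\frac12\log_2T\rceil$, $\eta_i=2^{-i}/(5GD)$ and $\pi_i=\bigl(1+\frac1{1+m}\bigr)\frac1{(i+1)(i+2)}$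 for $0\le i\le m$. In each algorithm write $x_t$ for its action and $g_t=\nabla f_t(x_t)$, and put $\ell^\eta_t(u)=-\eta\langle g_t,x_t-u\rangle+\eta^2\langle g_t,x_t-u\rangle^2$, $s^\eta_t(u)=-\eta\langle g_t,x_t-u\rangle+\eta^2G^2\|x_t-u\|^2$, $c_t(u)=-\eta^c\langle g_t,x_t-u\rangle+(\eta^cGD)^2$ with $\eta^c=1/(2GD\sqrt T)$. \emph{MetaGrad (full version).} There is one slave for each $\eta=\eta_i$, with prediction $w^i_1=x_1$ and weight $\pi^i_1=\pi_i$. The action is $x_t=\sum_i\pi^i_t\eta_iw^i_t/\sum_i\pi^i_t\eta_i$. Updates: $\pi^i_{t+1}\propto\pi^i_te^{-\ell^{\eta_i}_t(w^i_t)}$ (normalized to sum $1$) and, with $P=D^{-2}I+2\eta_i^2\sum_{s\le t}g_sg_s^\top$, $w^i_{t+1}=\Pi^{P}\bigl(w^i_t-\eta_i(1+2\eta_i\langle g_t,w^i_t-x_t\rangle)P^{-1}g_t\bigr)$. \emph{Maler.} The experts are a convex expert (rate $\eta^c$, initial weight $1/3$, surrogate loss $c_t$) and, for each $i$, an exp-concave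 and a strongly convex expert (rate $\eta_i$, initial weight $\pi_i/3$ each, surrogate losses $\ell^{\eta_i}_t$ and $s^{\eta_i}_t$). All predictions start at $x_1$. The action is the average of the predictions with coefficients proportional to weight times rate. After each round each weight is multiplied by $e^{-(\text{surrogate loss of the expert's prediction})}$ and the weights are normalized to sum $1$. Predictions $u$ are updated as follows: convex, $u\mapsto\Pi\bigl(u-\frac{D}{\eta^cG\sqrt t}\nabla c_t(u)\bigr)$; strongly convex, $u\mapsto\Pi\bigl(u-\frac1{2\eta_i^2G^2t}\nabla s^{\eta_i}_t(u)\bigr)$; exp-concave, with $\beta=\frac12$, $\Sigma_1=\frac1{\beta^2D^2}I$ and $\Sigma_{t+1}=\Sigma_t+\nabla\ell^{\eta_i}_t(u)\nabla\ell^{\eta_i}_t(u)^\top$, $u\mapsto\Pi^{\Sigma_{t+1}}\bigl(u-\frac1\beta\Sigma_{t+1}^{-1}\nabla\ell^{\eta_i}_t(u)\bigr)$. \emph{USC} with a set $\mathcal E$ of $N\ge2$ experts (online algorithms, each run on $f_1,f_2,\dots$, with predictions $x^j_t\in\mathcal X$) uses Adapt-ML-Prod as meta-algorithm. The action is $x_t=\sum_jp^j_tx^j_t$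 with $p^j_t\propto\eta^j_{t-1}w^j_{t-1}$ (summing to $1$), where $w^j_0=1/N$, $\ell^j_t=(\langle g_t,x^j_t-x_t\rangle+GD)/(2GD)$, $r^j_t=\sum_ip^i_t\ell^i_t-\ell^j_t$, $\eta^j_t=\min\bigl\{\frac12,\sqrt{\log N/(1+\sum_{s\le t}(r^j_s)^2)}\bigr\}$ and $w^j_t=\bigl(w^j_{t-1}(1+\eta^j_{t-1}r^j_t)\bigr)^{\eta^j_t/\eta^j_{t-1}}$. \textbf{Statement.} Let $\alpha>0$, $\gamma=\frac12\min\{1/(GD),\alpha\}$ and $T\ge2$, and suppose that $(f_1,\dots,f_T)$ is $k$-contaminated $\alpha$-exp-concave. Then MetaGrad and Maler satisfy $$R_T\le C\Bigl(\frac d\gamma\log T+GD\sqrt{kd\log T}\Bigr)$$ with an absolute constant $C$. Moreover, for every $c>0$ there is a constant $C$ depending only on $c$ such that the same bound holds for USC with any set of $N$ experts, $2\le N\le c\log T$, one of which is MetaGrad or Maler (with the same $\mathcal X,G,D,T,x_1$). -/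

import Mathlib

namespace ContaminatedOCO

open scoped Matrix

noncomputable section

/-! ## The online protocol -/

/-- The ambient space `ℝ^d` with its Euclidean norm. -/
abbrev Vec (d : ℕ) : Type := EuclideanSpace ℝ (Fin d)

/-- What is revealed to a learner at the end of a round: the loss function and its gradient.
That `grad` is the gradient of `val` on the feasible set is part of `IsOCOInstance` below. -/
structure Loss (d : ℕ) where
  val : Vec d → ℝ
  grad : Vec d → Vec d

/-- A deterministic online algorithm: it plays `action s` in its current state `s`, then sees the
loss of the round and moves to its next state. -/
structure OnlineAlgorithm (d : ℕ) where
  State : Type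
  init : State
  action : State → Vec d
  update : State → Loss d → State

namespace OnlineAlgorithm

/-- The state before the loss with index `t` is revealed.  Rounds are indexed from `0`, so index
`t` is the round number `t + 1`. -/
def stateAt {d : ℕ} (A : OnlineAlgorithm d) (f : ℕ → Loss d) : ℕ → A.State
  | 0 => A.init
  | t + 1 => A.update (A.stateAt f t) (f t)

/-- The action played in the round with index `t` against the losses `f`. -/
def play {d : ℕ} (A : OnlineAlgorithm d) (f : ℕ → Loss d) (t : ℕ) : Vec d :=
  A.action (A.stateAt f t)

/-- The regret after `T` rounds.  On a nonempty compact set `X` and for losses that are continuous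
on `X` the infimum is a minimum. -/
def regret {d : ℕ} (A : OnlineAlgorithm d) (X : Set (Vec d)) (f : ℕ → Loss d) (T : ℕ) : ℝ :=
  (∑ t ∈ Finset.range T, (f t).val (A.play f t)) -
    sInf ((fun x => ∑ t ∈ Finset.range T, (f t).val x) '' X)

end OnlineAlgorithm

/-! ## Standing assumptions and contaminated sequences -/

/-- The standing assumptions: a nonempty closed convex feasible set of diameter at most `D`, and
convex differentiable losses with gradients bounded by `G` on it, in the first `T` rounds.
Differentiability is relative to `X`, since only the values on `X` matter. -/
structure IsOCOInstance {d : ℕ} (X : Set (Vec d)) (G D : ℝ) (T : ℕ) (f : ℕ → Loss d) : Prop where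
  nonempty : X.Nonempty
  closed : IsClosed X
  convex : Convex ℝ X
  D_pos : 0 < D
  G_pos : 0 < G
  dist_le : ∀ x ∈ X, ∀ y ∈ X, ‖x - y‖ ≤ D
  convexOn : ∀ t < T, ConvexOn ℝ X (f t).val
  hasGradient : ∀ t < T, ∀ x ∈ X, HasGradientWithinAt (f t).val ((f t).grad x) X x
  grad_le : ∀ t < T, ∀ x ∈ X, ‖(f t).grad x‖ ≤ G

/-- `f` is `α`-exp-concave on `X`. -/
def IsExpConcave {d : ℕ} (α : ℝ) (X : Set (Vec d)) (f : Vec d → ℝ) : Prop :=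
  ConcaveOn ℝ X (fun x => Real.exp (-α * f x))

/-- All but `k` of the first `T` losses belong to the class `F`. -/
def IsContaminated {d : ℕ} (F : (Vec d → ℝ) → Prop) (k T : ℕ) (f : ℕ → Loss d) : Prop :=
  ∃ I : Finset ℕ, I ⊆ Finset.range T ∧ I.card = k ∧ ∀ t ∈ Finset.range T \ I, F (f t).val

/-! ## Common ingredients of the algorithms -/

/-- The generalized projection of `y` onto `X`: a minimizer over `x ∈ X` of
`(y - x)ᵀ A (y - x)`.  It exists and is unique if `X` is nonempty, closed and convex and `A` is
positive definite. -/
def proj {d : ℕ} (X : Set (Vec d)) (A : Matrix (Fin d) (Fin d) ℝ) (y : Vec d) : Vec d :=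
  Classical.epsilon fun x => x ∈ X ∧
    ∀ z ∈ X, inner ℝ (y - x) (A.toEuclideanLin (y - x)) ≤ inner ℝ (y - z) (A.toEuclideanLin (y - z))

/-- The rank-one matrix `v vᵀ`. -/
def outer {d : ℕ} (v : Vec d) : Matrix (Fin d) (Fin d) ℝ :=
  Matrix.vecMulVec v.ofLp v.ofLp

/-- The number `⌈(1/2) log₂ T⌉`: the learning rates are indexed by `0, …, gridTop T`. -/
def gridTop (T : ℕ) : ℕ := ⌈(1 / 2 : ℝ) * Real.logb 2 T⌉₊

/-- The learning rates `2^{-i} / (5 G D)`. -/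
def rate (G D : ℝ) (i : ℕ) : ℝ := 1 / (2 ^ i * (5 * G * D))

/-- The prior weights `C / ((i + 1) (i + 2))` with `C = 1 + 1 / (1 + ⌈(1/2) log₂ T⌉)`. -/
def prior (T i : ℕ) : ℝ := (1 + 1 / (1 + (gridTop T : ℝ))) / (((i : ℝ) + 1) * ((i : ℝ) + 2))

/-- The surrogate loss `ℓ^η`, for the master's action `x` and the gradient `g` at `x`. -/
def surrogateExp {d : ℕ} (η : ℝ) (x g u : Vec d) : ℝ :=
  -η * inner ℝ g (x - u) + η ^ 2 * (inner ℝ g (x - u)) ^ 2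

/-- The surrogate loss `s^η`. -/
def surrogateStrong {d : ℕ} (G η : ℝ) (x g u : Vec d) : ℝ :=
  -η * inner ℝ g (x - u) + η ^ 2 * G ^ 2 * ‖x - u‖ ^ 2

/-- The surrogate loss `c`, for the learning rate `η = η^c`. -/
def surrogateConv {d : ℕ} (G D η : ℝ) (x g u : Vec d) : ℝ :=
  -η * inner ℝ g (x - u) + (η * G * D) ^ 2

/-! ## MetaGrad (full version) -/

/-- `gram` is the sum of `g gᵀ` over the gradients seen so far, `point i` the prediction and
`weight i` the weight of the slave with learning rate `rate G D i`. -/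
structure MetaGradState (d T : ℕ) where
  gram : Matrix (Fin d) (Fin d) ℝ
  point : Fin (gridTop T + 1) → Vec d
  weight : Fin (gridTop T + 1) → ℝ

/-- The tilted average of the slaves' predictions. -/
def MetaGradState.action {d T : ℕ} (G D : ℝ) (s : MetaGradState d T) : Vec d :=
  (∑ i, s.weight i * rate G D i)⁻¹ • ∑ i, (s.weight i * rate G D i) • s.point i

/-- The inverse covariance `Σ⁻¹ = D⁻² I + 2 η² ∑ g gᵀ` of a slave. -/
def metaGradPrecision {d : ℕ} (D η : ℝ) (gram : Matrix (Fin d) (Fin d) ℝ) :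
    Matrix (Fin d) (Fin d) ℝ :=
  (1 / D ^ 2) • (1 : Matrix (Fin d) (Fin d) ℝ) + (2 * η ^ 2) • gram

/-- The slave's step from `w`, for the master's action `x` and the gradient `g` at `x`; `P` is the
updated inverse covariance. -/
def metaGradSlaveStep {d : ℕ} (X : Set (Vec d)) (η : ℝ) (P : Matrix (Fin d) (Fin d) ℝ)
    (x g w : Vec d) : Vec d :=
  proj X P (w - (η * (1 + 2 * η * inner ℝ g (w - x))) • P⁻¹.toEuclideanLin g)

/-- MetaGrad on `X` for horizon `T`, all slaves starting at `x₁`. -/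
def metaGrad {d : ℕ} (X : Set (Vec d)) (G D : ℝ) (T : ℕ) (x₁ : Vec d) : OnlineAlgorithm d where
  State := MetaGradState d T
  init :=
    { gram := 0
      point := fun _ => x₁
      weight := fun i => prior T i }
  action := MetaGradState.action G D
  update := fun s f =>
    let x := s.action G D
    let g := f.grad x
    let gram' := s.gram + outer g
    let v := fun i : Fin (gridTop T + 1) =>
      s.weight i * Real.exp (-surrogateExp (rate G D i) x g (s.point i))
    { gram := gram'
      point := fun i =>
        metaGradSlaveStep X (rate G D i) (metaGradPrecision D (rate G D i) gram') x g (s.point i)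
      weight := fun i => v i / ∑ j, v j }

/-! ## Maler -/

/-- `round` is the number of the current round, counted from `1`.  The three families of experts
are marked `C` (convex), `E` (exp-concave) and `S` (strongly convex); `sigmaE i` is the matrix kept
by the exp-concave expert `i`. -/
structure MalerState (d T : ℕ) where
  round : ℕ
  pointC : Vec d
  pointE : Fin (gridTop T + 1) → Vec d
  pointS : Fin (gridTop T + 1) → Vec d
  sigmaE : Fin (gridTop T + 1) → Matrix (Fin d) (Fin d) ℝ
  weightC : ℝ
  weightE : Fin (gridTop T + 1) → ℝ
  weightS : Fin (gridTop T + 1) → ℝ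

/-- The learning rate `η^c = 1 / (2 G D √T)`. -/
def malerRateC (G D : ℝ) (T : ℕ) : ℝ := 1 / (2 * G * D * Real.sqrt T)

/-- The tilted average of the experts' predictions. -/
def MalerState.action {d T : ℕ} (G D : ℝ) (s : MalerState d T) : Vec d :=
  (s.weightC * malerRateC G D T +
      ∑ i, (s.weightS i * rate G D i + s.weightE i * rate G D i))⁻¹ •
    ((s.weightC * malerRateC G D T) • s.pointC +
      ∑ i, ((s.weightS i * rate G D i) • s.pointS i + (s.weightE i * rate G D i) • s.pointE i))

/-- Maler on `X` for horizon `T`, all experts starting at `x₁`.  The exp-concave experts are Online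
Newton Step with `β = 1/2` on the surrogates `ℓ^η`, the other experts projected gradient descent on
the surrogates `c` and `s^η`. -/
def maler {d : ℕ} (X : Set (Vec d)) (G D : ℝ) (T : ℕ) (x₁ : Vec d) : OnlineAlgorithm d where
  State := MalerState d T
  init :=
    { round := 1
      pointC := x₁
      pointE := fun _ => x₁
      pointS := fun _ => x₁
      sigmaE := fun _ => (1 / ((1 / 2 : ℝ) ^ 2 * D ^ 2)) • (1 : Matrix (Fin d) (Fin d) ℝ)
      weightC := 1 / 3
      weightE := fun i => prior T i / 3
      weightS := fun i => prior T i / 3 }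
  action := MalerState.action G D
  update := fun s f =>
    let x := s.action G D
    let g := f.grad x
    let ηc := malerRateC G D T
    let gradC := gradient (surrogateConv G D ηc x g) s.pointC
    let gradE := fun i : Fin (gridTop T + 1) =>
      gradient (surrogateExp (rate G D i) x g) (s.pointE i)
    let gradS := fun i : Fin (gridTop T + 1) =>
      gradient (surrogateStrong G (rate G D i) x g) (s.pointS i)
    let sigma' := fun i : Fin (gridTop T + 1) => s.sigmaE i + outer (gradE i)
    let vC := s.weightC * Real.exp (-surrogateConv G D ηc x g s.pointC)
    let vE := fun i : Fin (gridTop T + 1) =>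
      s.weightE i * Real.exp (-surrogateExp (rate G D i) x g (s.pointE i))
    let vS := fun i : Fin (gridTop T + 1) =>
      s.weightS i * Real.exp (-surrogateStrong G (rate G D i) x g (s.pointS i))
    let Φ := vC + ∑ i, (vS i + vE i)
    { round := s.round + 1
      pointC := proj X 1 (s.pointC - (D / (ηc * G * Real.sqrt s.round)) • gradC)
      pointE := fun i =>
        proj X (sigma' i) (s.pointE i - (1 / (1 / 2 : ℝ)) • (sigma' i)⁻¹.toEuclideanLin (gradE i))
      pointS := fun i =>
        proj X 1 (s.pointS i - (1 / (2 * rate G D i ^ 2 * G ^ 2 * s.round)) • gradS i)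
      sigmaE := sigma'
      weightC := vC / Φ
      weightE := fun i => vE i / Φ
      weightS := fun i => vS i / Φ }

/-! ## USC -/

/-- `expert i` is the internal state of the expert `i`, `weight i` its Adapt-ML-Prod weight `w^i`
and `sq i` the sum of `(ℓ_s - ℓ_s^i)²` over the past rounds. -/
structure USCState {d N : ℕ} (A : Fin N → OnlineAlgorithm d) where
  expert : (i : Fin N) → (A i).State
  weight : Fin N → ℝ
  sq : Fin N → ℝ

/-- The Adapt-ML-Prod learning rate `min {1/2, √(log N / (1 + S))}`. -/
def uscRate (N : ℕ) (S : ℝ) : ℝ := min (1 / 2) (Real.sqrt (Real.log N / (1 + S)))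

/-- The probability `p^i`, proportional to `η^i w^i`. -/
def USCState.prob {d N : ℕ} {A : Fin N → OnlineAlgorithm d} (s : USCState A) (i : Fin N) : ℝ :=
  uscRate N (s.sq i) * s.weight i / ∑ j, uscRate N (s.sq j) * s.weight j

/-- The weighted average of the experts' predictions. -/
def USCState.action {d N : ℕ} {A : Fin N → OnlineAlgorithm d} (s : USCState A) : Vec d :=
  ∑ i, s.prob i • (A i).action (s.expert i)

/-- USC with the experts `A 0, …, A (N - 1)`: the meta-algorithm Adapt-ML-Prod is run on the
normalized linearized losses `ℓ_t^i = (⟨∇f_t(x_t), x_t^i - x_t⟩ + G D) / (2 G D)`, and every expert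
is run on the losses `f_t` themselves. -/
def usc {d N : ℕ} (G D : ℝ) (A : Fin N → OnlineAlgorithm d) : OnlineAlgorithm d where
  State := USCState A
  init :=
    { expert := fun i => (A i).init
      weight := fun _ => 1 / (N : ℝ)
      sq := fun _ => 0 }
  action := USCState.action
  update := fun s f =>
    let x := s.action
    let loss := fun i : Fin N =>
      (inner ℝ (f.grad x) ((A i).action (s.expert i) - x) + G * D) / (2 * G * D)
    let r := fun i : Fin N => (∑ j, s.prob j * loss j) - loss i
    { expert := fun i => (A i).update (s.expert i) f
      weight := fun i =>
        (s.weight i * (1 + uscRate N (s.sq i) * r i)) ^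
          (uscRate N (s.sq i + r i ^ 2) / uscRate N (s.sq i))
      sq := fun i => s.sq i + r i ^ 2 }

/-! ## The bound -/

/-- The constant `γ = (1/2) min {1/(G D), α}`. -/
def gammaConst (G D α : ℝ) : ℝ := (1 / 2) * min (1 / (G * D)) α

/-- The rate `(d/γ) log T + G D √(k d log T)`. -/
def regretRate (d T k : ℕ) (G D α : ℝ) : ℝ :=
  (d : ℝ) / gammaConst G D α * Real.log T + G * D * Real.sqrt ((k : ℝ) * d * Real.log T)

end

end ContaminatedOCO

open ContaminatedOCO

/-!
The argument rests on second-order regret bounds for the linearized losses. Write `x t` for the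
actions, `g t` for the gradients at them and `V = ∑ ⟨g t, x t - u⟩ ^ 2`. If an algorithm satisfies
`∑ ⟨g t, x t - u⟩ ≤ a G D A + b √(V A)`, then its regret adapts to contamination by itself
(`sum_sub_le_of_second_order`). In an exp-concave round the loss difference is at most
`⟨g t, x t - u⟩ - γ / 2 * ⟨g t, x t - u⟩ ^ 2` (`IsExpConcave.sub_le`), and by the inequality of
arithmetic and geometric means the curvature term pays for the part of `√(V A)` due to these rounds,
up to `A / γ`. The `k` contaminated rounds contribute at most `k (G D) ^ 2` to `V`, hence
`G D √(k A)` to the regret.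

For MetaGrad and Maler the second-order bound holds with `A` of order `d log T`. The master's action
is a tilted mean, which keeps the normalizing constants of the exponential weights at most `1`, so
the master loses at most `log (1 / prior)` to each slave in its own surrogate loss
(`neg_sum_loss_le_neg_log`). A slave with surrogate `ℓ^η` runs projected Newton steps, whose regret
is at most a constant plus a log-determinant, of order `d log T` (`newton_regret`); the slaves of
MetaGrad and the exp-concave experts of Maler are two parametrizations of these steps. Since
`-ℓ^η` summed over the rounds is `η ∑ ⟨g t, x t - u⟩ - η ^ 2 V`, optimizing over the geometric grid
of rates yields the bound (`le_sqrt_of_forall_rate`).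

For USC the regret splits into that of the distinguished expert, bounded as above, and the regret
towards this expert, whose actions serve as time-varying comparators. The second-order bound for the
latter is that of Adapt-ML-Prod (`adaptMLProd_regret`), obtained from upper and lower bounds on the
sum of the weights. With `N ≤ c log T` experts the logarithm of that sum is at most of order `√(log T)`, so
that all terms are of order `log T` and `√(V log T)` (`adaptMLProd_bound_le`).
-/

namespace ContaminatedOCO

open scoped Matrix

/-! ### Scalar inequalities -/

theorem exp_sub_sq_le_one_add {z : ℝ} (hz : -(1 / 2) ≤ z) : Real.exp (z - z ^ 2) ≤ 1 + z := by
  have hpos : 0 < 1 + z := by linarith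
  rw [← Real.le_log_iff_exp_le hpos]
  rcases le_total 0 z with h | h
  · refine le_trans ?_ (Real.le_log_one_add_of_nonneg h)
    rw [le_div_iff₀ (by linarith)]
    nlinarith [pow_nonneg h 3, sq_nonneg z]
  · have h1 : 0 ≤ -(z - z ^ 2) := by nlinarith [sq_nonneg z]
    have h2 := Real.quadratic_le_exp_of_nonneg h1
    rw [Real.le_log_iff_exp_le hpos, ← inv_le_inv₀ hpos (Real.exp_pos _), ← Real.exp_neg]
    refine le_trans ?_ h2
    rw [inv_le_iff_one_le_mul₀ hpos]
    have h3 : 0 ≤ z ^ 2 * ((1 + z) * (1 - z) ^ 2 + 2 * z) :=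
      mul_nonneg (sq_nonneg z) (by nlinarith [sq_nonneg z, mul_nonneg (sub_nonneg.2 hz) (neg_nonneg.2 h)])
    nlinarith [h3]

theorem one_sub_le_exp_neg_sub_sq {z : ℝ} (hz : |z| ≤ 1) :
    1 - z ≤ Real.exp (-z - z ^ 2 / 4) := by
  obtain ⟨h1, h2⟩ := abs_le.1 hz
  -- For `z ≥ 0` the first two terms of the series of `-log (1 - z)` suffice.
  rcases le_total 0 z with h | h
  · rcases h2.eq_or_lt with rfl | h2
    · simpa using (Real.exp_pos _).le
    · have hs := Real.hasSum_pow_div_log_of_abs_lt_one (x := z) (by rw [abs_of_nonneg h]; exact h2)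
      have h3 := sum_le_hasSum (Finset.range 2) (fun i _ => by positivity) hs
      simp only [Finset.sum_range_succ, Finset.sum_range_zero] at h3
      norm_num at h3
      rw [← Real.log_le_iff_le_exp (by linarith)]
      nlinarith [sq_nonneg z]
  · have h3 : 0 ≤ -z - z ^ 2 / 4 := by nlinarith
    refine le_trans ?_ (Real.quadratic_le_exp_of_nonneg h3)
    nlinarith [mul_nonneg (sq_nonneg z) (neg_nonneg.2 h), sq_nonneg (z ^ 2)]

theorem sqrt_add_le_sqrt_add_sqrt {a b : ℝ} (ha : 0 ≤ a) (hb : 0 ≤ b) :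
    Real.sqrt (a + b) ≤ Real.sqrt a + Real.sqrt b := by
  rw [Real.sqrt_le_left (by positivity), add_sq, Real.sq_sqrt ha, Real.sq_sqrt hb]
  have : 0 ≤ 2 * Real.sqrt a * Real.sqrt b := by positivity
  linarith

theorem log_one_add_le_two_mul {T : ℕ} (hT : 2 ≤ T) : Real.log (1 + T) ≤ 2 * Real.log T := by
  have hT' : (2 : ℝ) ≤ T := by exact_mod_cast hT
  rw [← Real.log_rpow (by linarith) 2]
  apply Real.log_le_log (by linarith)
  rw [Real.rpow_two]
  nlinarith

theorem one_le_two_mul_log {T : ℕ} (hT : 2 ≤ T) : 1 ≤ 2 * Real.log T := by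
  have hT' : (2 : ℝ) ≤ T := by exact_mod_cast hT
  linarith [Real.log_two_gt_d9, Real.log_le_log two_pos hT']

/-! ### First-order inequalities on the feasible set -/

/-- The gradient inequality for a function that is only differentiable relative to the convex
set `X`; the derivative is taken along the segment from `x` to `u`. -/
theorem inner_gradientWithin_le_sub {d : ℕ} {X : Set (Vec d)} {φ : Vec d → ℝ}
    (hφ : ConvexOn ℝ X φ) {x u v : Vec d} (hx : x ∈ X) (hu : u ∈ X)
    (hv : HasGradientWithinAt φ v X x) : inner ℝ v (u - x) ≤ φ u - φ x := by
  have hmaps : Set.MapsTo (AffineMap.lineMap x u : ℝ → Vec d) (Set.Icc 0 1) X :=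
    fun s hs => hφ.1.lineMap_mem hx hu hs
  have hline : HasDerivWithinAt (AffineMap.lineMap x u : ℝ → Vec d) (u - x) (Set.Icc 0 1) 0 :=
    AffineMap.hasDerivWithinAt_lineMap
  have hv' := hv.hasFDerivWithinAt
  rw [← AffineMap.lineMap_apply_zero (k := ℝ) x u] at hv'
  have hder := hv'.comp_hasDerivWithinAt (0 : ℝ) hline hmaps
  have hconv : ConvexOn ℝ (Set.Icc (0 : ℝ) 1) (φ ∘ (AffineMap.lineMap x u : ℝ → Vec d)) :=
    (hφ.comp_affineMap (AffineMap.lineMap x u : ℝ →ᵃ[ℝ] Vec d)).subset hmaps (convex_Icc 0 1)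
  have := hconv.le_slope_of_hasDerivWithinAt (x := 0) (y := 1) (by simp) (by simp) one_pos hder
  simpa [slope_def_field] using this

/-- An `α`-exp-concave function satisfies a quadratically strengthened gradient inequality, with
curvature constant `gammaConst G D α`. -/
theorem IsExpConcave.sub_le {d : ℕ} {X : Set (Vec d)} {G D α : ℝ} (hG : 0 < G) (hD : 0 < D)
    (hα : 0 < α) {φ : Vec d → ℝ} (hφ : IsExpConcave α X φ) {x u v : Vec d} (hx : x ∈ X)
    (hu : u ∈ X) (hv : HasGradientWithinAt φ v X x) (hb : |inner ℝ v (x - u)| ≤ G * D) :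
    φ x - φ u ≤ inner ℝ v (x - u) - gammaConst G D α / 2 * (inner ℝ v (x - u)) ^ 2 := by
  have hGD : 0 < G * D := mul_pos hG hD
  set γ := gammaConst G D α with hγ
  have hγpos : 0 < γ := by rw [hγ, gammaConst]; positivity
  have hγ1 : 2 * γ * (G * D) ≤ 1 := by
    have : 2 * γ ≤ 1 / (G * D) := by
      rw [hγ, gammaConst]; linarith [min_le_left (1 / (G * D)) α]
    rwa [le_div_iff₀ hGD] at this
  have hγ2 : 2 * γ ≤ α := by rw [hγ, gammaConst]; linarith [min_le_right (1 / (G * D)) α]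
  set p := inner ℝ v (x - u) with hp
  have hgrad : HasGradientWithinAt (-(fun y => Real.exp (-α * φ y)))
      ((α * Real.exp (-α * φ x)) • v) X x := by
    rw [hasGradientWithinAt_iff_hasFDerivWithinAt]
    have := ((hv.hasFDerivWithinAt.const_mul (-α)).exp).neg
    refine this.congr_fderiv ?_
    ext y
    simp
    ring
  have hfirst := inner_gradientWithin_le_sub (ConcaveOn.neg hφ) hx hu hgrad
  rw [inner_smul_left, ← neg_sub x u, inner_neg_right, ← hp] at hfirst
  simp only [Pi.neg_apply, RCLike.conj_to_real] at hfirst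
  have hΔ : Real.exp (-α * (φ u - φ x)) ≤ 1 + -(-(α * p)) := by
    have h1 : Real.exp (-α * (φ u - φ x)) * Real.exp (-α * φ x) = Real.exp (-α * φ u) := by
      rw [← Real.exp_add]; ring_nf
    have h2 := Real.exp_pos (-α * φ x)
    rw [← mul_le_mul_iff_left₀ h2, h1]
    linarith
  -- Bernoulli's inequality lowers the exponent from `α` to `2 γ`.
  have hbern : Real.exp (-(2 * γ) * (φ u - φ x)) ≤ 1 + 2 * γ * p := by
    have h0 : 0 ≤ 1 + α * p := by
      have := (Real.exp_pos (-α * (φ u - φ x))).le.trans hΔ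
      linarith
    have h1 := rpow_one_add_le_one_add_mul_self (s := α * p) (by linarith) (p := 2 * γ / α)
      (by positivity) (by rw [div_le_one hα]; exact hγ2)
    have h2 := Real.rpow_le_rpow (Real.exp_pos _).le hΔ (z := 2 * γ / α) (by positivity)
    rw [← Real.exp_mul, neg_neg] at h2
    have h3 : -α * (φ u - φ x) * (2 * γ / α) = -(2 * γ) * (φ u - φ x) := by field_simp
    have h4 : 2 * γ / α * (α * p) = 2 * γ * p := by field_simp
    rw [h3] at h2
    rw [h4] at h1
    exact h2.trans h1
  have habs : |-(2 * γ * p)| ≤ 1 := by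
    rw [abs_neg, abs_mul, abs_of_pos (by positivity : 0 < 2 * γ)]
    exact (mul_le_mul_of_nonneg_left hb (by positivity)).trans hγ1
  have hexp := one_sub_le_exp_neg_sub_sq habs
  have := Real.exp_le_exp.1 (hbern.trans (by linarith))
  have h5 : 2 * γ * (φ x - φ u) ≤ 2 * γ * (p - γ / 2 * p ^ 2) := by linarith
  exact le_of_mul_le_mul_left h5 (by positivity)

/-! ### Quadratic forms, projections and log-determinants -/

/-- The squared length of `v` in the geometry of the matrix `A`. -/
noncomputable def quad {d : ℕ} (A : Matrix (Fin d) (Fin d) ℝ) (v : Vec d) : ℝ :=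
  inner ℝ v (A.toEuclideanLin v)

theorem toEuclideanLin_outer {d : ℕ} (h v : Vec d) :
    (outer h).toEuclideanLin v = (inner ℝ h v : ℝ) • h := by
  ext i
  simp only [outer, Matrix.ofLp_toLpLin, Matrix.toLin'_apply, Matrix.vecMulVec_mulVec, PiLp.smul_apply,
    PiLp.inner_apply]
  simp [dotProduct, mul_comm]

theorem outer_smul {d : ℕ} (c : ℝ) (g : Vec d) : outer (c • g) = c ^ 2 • outer g := by
  simp [outer, Matrix.smul_vecMulVec, Matrix.vecMulVec_smul, smul_smul, sq]

theorem quad_add_outer {d : ℕ} (A : Matrix (Fin d) (Fin d) ℝ) (h v : Vec d) :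
    quad (A + outer h) v = quad A v + (inner ℝ h v) ^ 2 := by
  simp only [quad, map_add, LinearMap.add_apply, inner_add_right, toEuclideanLin_outer,
    inner_smul_right, real_inner_comm h v]
  ring

theorem quad_smul_one {d : ℕ} (p : ℝ) (v : Vec d) :
    quad (p • (1 : Matrix (Fin d) (Fin d) ℝ)) v = p * ‖v‖ ^ 2 := by
  have : (1 : Matrix (Fin d) (Fin d) ℝ).toEuclideanLin v = v := by
    ext i; simp
  simp only [quad, map_smul, LinearMap.smul_apply, this, inner_smul_right, real_inner_self_eq_norm_sq]

theorem inner_toEuclideanLin_comm {d : ℕ} {A : Matrix (Fin d) (Fin d) ℝ} (hA : A.PosDef)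
    (v w : Vec d) : inner ℝ v (A.toEuclideanLin w) = inner ℝ w (A.toEuclideanLin v) := by
  rw [← (Matrix.isSymmetric_toEuclideanLin_iff.2 hA.1) v w, real_inner_comm]

theorem quad_nonneg {d : ℕ} {A : Matrix (Fin d) (Fin d) ℝ} (hA : A.PosDef) (v : Vec d) :
    0 ≤ quad A v := by
  have := (Matrix.isPositive_toEuclideanLin_iff.2 hA.posSemidef).inner_nonneg_right v
  simpa [quad] using this

theorem quad_add {d : ℕ} {A : Matrix (Fin d) (Fin d) ℝ} (hA : A.PosDef) (v w : Vec d) :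
    quad A (v + w) = quad A v + 2 * inner ℝ v (A.toEuclideanLin w) + quad A w := by
  simp only [quad, map_add, inner_add_left, inner_add_right, inner_toEuclideanLin_comm hA w v]
  ring

theorem quad_smul {d : ℕ} (A : Matrix (Fin d) (Fin d) ℝ) (c : ℝ) (v : Vec d) :
    quad A (c • v) = c ^ 2 * quad A v := by
  simp only [quad, map_smul, inner_smul_left, inner_smul_right, RCLike.conj_to_real]
  ring

theorem posDef_add_outer {d : ℕ} {A : Matrix (Fin d) (Fin d) ℝ} (hA : A.PosDef) (h : Vec d) :
    (A + outer h).PosDef :=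
  hA.add_posSemidef (by simpa [outer] using Matrix.posSemidef_vecMulVec_self_star h.ofLp)

theorem proj_spec {d : ℕ} {X : Set (Vec d)} (hX : IsCompact X) (hne : X.Nonempty)
    (A : Matrix (Fin d) (Fin d) ℝ) (y : Vec d) :
    proj X A y ∈ X ∧ ∀ z ∈ X, quad A (y - proj X A y) ≤ quad A (y - z) := by
  have hcont : Continuous fun x : Vec d => quad A (y - x) := by
    have : Continuous A.toEuclideanLin := LinearMap.continuous_of_finiteDimensional _
    unfold quad
    fun_prop
  obtain ⟨x, hx, hmin⟩ := hX.exists_isMinOn hne hcont.continuousOn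
  exact Classical.epsilon_spec (p := fun x => x ∈ X ∧ ∀ z ∈ X,
    inner ℝ (y - x) (A.toEuclideanLin (y - x)) ≤ inner ℝ (y - z) (A.toEuclideanLin (y - z)))
    ⟨x, hx, fun z hz => hmin hz⟩

/-- The Pythagorean inequality: projecting onto `X` does not increase distances to `X`. -/
theorem quad_proj_sub_le {d : ℕ} {X : Set (Vec d)} (hX : IsCompact X) (hconv : Convex ℝ X)
    {A : Matrix (Fin d) (Fin d) ℝ} (hA : A.PosDef) (y : Vec d) {u : Vec d} (hu : u ∈ X) :
    quad A (proj X A y - u) ≤ quad A (y - u) := by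
  obtain ⟨hp, hmin⟩ := proj_spec hX ⟨u, hu⟩ A y
  set p := proj X A y
  -- Minimality of `p` along the segment from `p` to `u`, divided by the step length `s`.
  have hvar : ∀ s ∈ Set.Ioc (0 : ℝ) 1,
      0 ≤ 2 * inner ℝ (y - p) (A.toEuclideanLin (p - u)) + s * quad A (p - u) := by
    intro s hs
    have h1 := hmin (p + s • (u - p)) (hconv.add_smul_sub_mem hp hu ⟨hs.1.le, hs.2⟩)
    have h2 : y - (p + s • (u - p)) = (y - p) + s • (p - u) := by
      rw [← neg_sub u p, smul_neg]; abel
    rw [h2, quad_add hA, quad_smul, map_smul, inner_smul_right] at h1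
    have h3 : 0 ≤ s * (2 * inner ℝ (y - p) (A.toEuclideanLin (p - u)) + s * quad A (p - u)) := by
      linarith
    exact nonneg_of_mul_nonneg_right h3 hs.1
  -- The limit `s → 0`, by inserting an `s` at which the quadratic term is too small.
  have hlim : 0 ≤ 2 * inner ℝ (y - p) (A.toEuclideanLin (p - u)) := by
    by_contra! hneg
    set b : ℝ := 2 * inner ℝ (y - p) (A.toEuclideanLin (p - u))
    have hq := quad_nonneg hA (p - u)
    have hs := hvar (min 1 (-b / (2 * (quad A (p - u) + 1))))
      ⟨lt_min one_pos (div_pos (by linarith) (by linarith)), min_le_left _ _⟩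
    have h4 : min 1 (-b / (2 * (quad A (p - u) + 1))) * quad A (p - u) ≤
        -b / (2 * (quad A (p - u) + 1)) * (quad A (p - u) + 1) :=
      mul_le_mul (min_le_right _ _) (by linarith) hq (div_nonneg (by linarith) (by linarith))
    have h5 : -b / (2 * (quad A (p - u) + 1)) * (quad A (p - u) + 1) = -b / 2 := by
      have : quad A (p - u) + 1 ≠ 0 := by linarith
      field_simp
    linarith
  have hsplit : y - u = (y - p) + (p - u) := by abel
  rw [hsplit, quad_add hA]
  linarith [quad_nonneg hA (y - p)]

/-- One generalized-projection step in the geometry of `P`. -/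
theorem quad_proj_step_le {d : ℕ} {X : Set (Vec d)} (hX : IsCompact X) (hconv : Convex ℝ X)
    {P : Matrix (Fin d) (Fin d) ℝ} (hP : P.PosDef) (w v : Vec d) (c : ℝ) {u : Vec d} (hu : u ∈ X) :
    quad P (proj X P (w - c • P⁻¹.toEuclideanLin v) - u) ≤
      quad P (w - u) - 2 * c * inner ℝ v (w - u) + c ^ 2 * quad P⁻¹ v := by
  refine (quad_proj_sub_le hX hconv hP _ hu).trans_eq ?_
  have hinv : P.toEuclideanLin (P⁻¹.toEuclideanLin v) = v := by
    ext i
    rw [Matrix.ofLp_toLpLin, Matrix.toLin'_apply, Matrix.ofLp_toLpLin, Matrix.toLin'_apply, Matrix.mulVec_mulVec,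
      Matrix.mul_nonsing_inv _ hP.det_pos.ne'.isUnit, Matrix.one_mulVec]
  have hsplit : w - c • P⁻¹.toEuclideanLin v - u = (w - u) + (-c) • P⁻¹.toEuclideanLin v := by
    rw [neg_smul]; abel
  rw [hsplit, quad_add hP, quad_smul, map_smul, inner_smul_right, hinv, real_inner_comm]
  simp only [quad, hinv, real_inner_comm v]
  ring

/-- A rank-one update changes the log-determinant at least as much as the squared length of the
update in the dual geometry. -/
theorem quad_inv_le_log_det_sub {d : ℕ} {P : Matrix (Fin d) (Fin d) ℝ} (hP : P.PosDef)
    (h : Vec d) :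
    quad (P + outer h)⁻¹ h ≤ Real.log (P + outer h).det - Real.log P.det := by
  set Q := P + outer h with hQ
  have hQpos : Q.PosDef := posDef_add_outer hP h
  -- The matrix determinant lemma, applied to `P = Q - h hᵀ`.
  have hdet : P.det = Q.det * (1 - quad Q⁻¹ h) := by
    have h1 := Matrix.det_add_replicateCol_mul_replicateRow (ι := Unit) hQpos.det_pos.ne'.isUnit
      (-h.ofLp) h.ofLp
    have h2 : Q + Matrix.replicateCol Unit (-h.ofLp) * Matrix.replicateRow Unit h.ofLp = P := by
      rw [← Matrix.vecMulVec_eq, Matrix.neg_vecMulVec, hQ, outer, add_neg_cancel_right]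
    rw [h2] at h1
    have h3 : (1 + Matrix.replicateRow Unit h.ofLp * Q⁻¹ *
        Matrix.replicateCol Unit (-h.ofLp)).det = 1 - quad Q⁻¹ h := by
      rw [Matrix.det_unique, Matrix.add_apply, Matrix.one_apply_eq, sub_eq_add_neg, Matrix.mul_assoc,
        Matrix.mul_apply', quad, PiLp.inner_apply]
      simp [dotProduct, Matrix.mul_apply, Matrix.mulVec, mul_comm]
    rw [h1, h3]
  have h3 := hP.det_pos
  have h4 := hQpos.det_pos
  have h5 : 0 < 1 - quad Q⁻¹ h := by
    rw [hdet] at h3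
    exact pos_of_mul_pos_right h3 h4.le
  rw [hdet, Real.log_mul h4.ne' h5.ne']
  linarith [Real.log_le_sub_one_of_pos h5]

theorem log_det_le_of_trace_le {d : ℕ} {P : Matrix (Fin d) (Fin d) ℝ} (hP : P.PosDef) {c : ℝ}
    (hc : 0 < c) (htr : P.trace ≤ d * c) : Real.log P.det ≤ d * Real.log c := by
  rw [hP.1.det_eq_prod_eigenvalues, Real.log_prod (fun i _ => by simpa using (hP.eigenvalues_pos i).ne')]
  rw [hP.1.trace_eq_sum_eigenvalues] at htr
  simp only [RCLike.ofReal_real_eq_id, id] at htr ⊢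
  -- The tangent line of the logarithm at `c` bounds the sum by the trace.
  have h1 : ∀ i, Real.log (hP.1.eigenvalues i) ≤ hP.1.eigenvalues i / c - 1 + Real.log c := by
    intro i
    have := Real.log_le_sub_one_of_pos (div_pos (hP.eigenvalues_pos i) hc)
    rw [Real.log_div (hP.eigenvalues_pos i).ne' hc.ne'] at this
    linarith
  calc ∑ i, Real.log (hP.1.eigenvalues i)
      ≤ ∑ i, (hP.1.eigenvalues i / c - 1 + Real.log c) := Finset.sum_le_sum fun i _ => h1 i
    _ = (∑ i, hP.1.eigenvalues i) / c - d + d * Real.log c := by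
        simp [Finset.sum_add_distrib, Finset.sum_div]
    _ ≤ d * Real.log c := by
        have : (∑ i, hP.1.eigenvalues i) / c ≤ d := by rwa [div_le_iff₀ hc]
        linarith

theorem trace_outer {d : ℕ} (h : Vec d) : (outer h).trace = ‖h‖ ^ 2 := by
  rw [outer, Matrix.trace_vecMulVec, ← real_inner_self_eq_norm_sq, PiLp.inner_apply]
  simp [dotProduct, sq]

/-! ### Online Newton steps -/

/-- Regret of projected Newton steps for linear losses `v t` with a quadratic gain in the direction
`h t`, where the geometry grows by `h t (h t)ᵀ` and `v t` is a bounded multiple of `h t`. -/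
theorem newton_regret {d T : ℕ} (hd : 0 < d) {X : Set (Vec d)} (hX : IsCompact X)
    (hconv : Convex ℝ X) {D p B c : ℝ} (hp : 0 < p) {P : ℕ → Matrix (Fin d) (Fin d) ℝ}
    {h v w : ℕ → Vec d} {b : ℕ → ℝ} (hP0 : P 0 = p • 1) (hP : ∀ t, P (t + 1) = P t + outer (h t))
    (hw : ∀ t, w (t + 1) = proj X (P (t + 1)) (w t - c • (P (t + 1))⁻¹.toEuclideanLin (v t)))
    (hv : ∀ t < T, v t = b t • h t) (hb : ∀ t < T, b t ^ 2 ≤ B) (hh : ∀ t < T, ‖h t‖ ^ 2 ≤ p)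
    {u : Vec d} (hu : u ∈ X) (hD : ‖w 0 - u‖ ≤ D) :
    ∑ t ∈ Finset.range T, (2 * c * inner ℝ (v t) (w t - u) - (inner ℝ (h t) (w t - u)) ^ 2) ≤
      p * D ^ 2 + c ^ 2 * B * (d * Real.log (1 + T)) := by
  have hpos : ∀ t, (P t).PosDef := by
    intro t
    induction t with
    | zero => rw [hP0]; exact Matrix.PosDef.one.smul hp
    | succ t ih => rw [hP]; exact posDef_add_outer ih _
  have htr : ∀ n ≤ T, (P n).trace ≤ p * d + n * p := by
    intro n
    induction n with
    | zero => intro _; simp [hP0]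
    | succ n ih =>
      intro hn
      rw [hP, Matrix.trace_add, trace_outer]
      push_cast
      linarith [ih (by omega), hh n (by omega)]
  -- The squared distance to `u` in the current geometry serves as potential.
  have hpot : ∀ n ≤ T, ∑ t ∈ Finset.range n, (2 * c * inner ℝ (v t) (w t - u) -
      (inner ℝ (h t) (w t - u)) ^ 2) + quad (P n) (w n - u) ≤
      quad (P 0) (w 0 - u) + c ^ 2 * B * (Real.log (P n).det - Real.log (P 0).det) := by
    intro n
    induction n with
    | zero => intro _; simp
    | succ n ih =>
      intro hn
      have h1 := quad_proj_step_le hX hconv (hpos (n + 1)) (w n) (v n) c hu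
      rw [← hw] at h1
      have h2 : quad (P (n + 1)) (w n - u) = quad (P n) (w n - u) + inner ℝ (h n) (w n - u) ^ 2 := by
        rw [hP, quad_add_outer]
      have h3 := quad_inv_le_log_det_sub (hpos n) (h n)
      rw [← hP] at h3
      have h4 : quad (P (n + 1))⁻¹ (v n) ≤
          B * (Real.log (P (n + 1)).det - Real.log (P n).det) := by
        rw [hv n (by omega), quad_smul]
        exact mul_le_mul (hb n (by omega)) h3 (quad_nonneg (hpos _).inv _)
          ((sq_nonneg _).trans (hb n (by omega)))
      have h5 := mul_le_mul_of_nonneg_left h4 (sq_nonneg c)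
      rw [Finset.sum_range_succ]
      linarith [ih (by omega)]
  have hdet0 : Real.log (P 0).det = d * Real.log p := by
    rw [hP0, Matrix.det_smul, Matrix.det_one, mul_one, Fintype.card_fin, Real.log_pow]
  have hdetT : Real.log (P T).det ≤ d * Real.log (p * (1 + T)) := by
    refine log_det_le_of_trace_le (hpos T) (by positivity) ((htr T le_rfl).trans ?_)
    have h1 : (1 : ℝ) ≤ d := by exact_mod_cast hd
    -- The trace grows by at most `p` per step, while the bound leaves room for `d p`.
    have h2 : 0 ≤ ((d : ℝ) - 1) * (T * p) := mul_nonneg (by linarith) (by positivity)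
    linarith
  rw [Real.log_mul hp.ne' (by positivity)] at hdetT
  have hquad0 : quad (P 0) (w 0 - u) ≤ p * D ^ 2 := by
    rw [hP0, quad_smul_one]
    gcongr
  rcases T.eq_zero_or_pos with rfl | hT
  · have : 0 ≤ p * D ^ 2 := by positivity
    simpa using this
  have hB : 0 ≤ B := (sq_nonneg _).trans (hb 0 hT)
  have h6 : c ^ 2 * B * (Real.log (P T).det - Real.log (P 0).det) ≤
      c ^ 2 * B * (d * Real.log (1 + T)) :=
    mul_le_mul_of_nonneg_left (by linarith) (by positivity)
  linarith [hpot T le_rfl, quad_nonneg (hpos T) (w T - u)]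

/-! ### Surrogate losses -/

theorem gradient_surrogateExp {d : ℕ} (η : ℝ) (x g u : Vec d) :
    gradient (surrogateExp η x g) u = (η * (1 + 2 * η * inner ℝ g (u - x))) • g := by
  apply HasGradientAt.gradient
  rw [hasGradientAt_iff_hasFDerivAt]
  have h1 : HasFDerivAt (fun y : Vec d => (inner ℝ g (x - y) : ℝ)) (-(innerSL ℝ g)) u := by
    have := (innerSL ℝ g).hasFDerivAt.comp u ((hasFDerivAt_id u).const_sub x)
    refine this.congr_fderiv ?_
    ext y; simp
  refine ((h1.const_mul (-η)).add ((h1.pow 2).const_mul (η ^ 2))).congr_fderiv ?_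
  ext y
  have h2 : (inner ℝ g (u - x) : ℝ) = -inner ℝ g (x - u) := by
    rw [← inner_neg_right, neg_sub]
  simp [h2]
  ring

theorem surrogateExp_sub {d : ℕ} (η : ℝ) (x g w u : Vec d) :
    surrogateExp η x g w - surrogateExp η x g u =
      inner ℝ ((η * (1 + 2 * η * inner ℝ g (w - x))) • g) (w - u) -
        η ^ 2 * (inner ℝ g (w - u)) ^ 2 := by
  simp only [surrogateExp, inner_smul_left, inner_sub_right, RCLike.conj_to_real]
  ring

/-- For each of the three surrogate losses, `exp (-loss)` lies below `1 + η * ⟨g, x - u⟩`. This common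
linear form lets experts of different kinds share one weighting scheme. -/
theorem exp_neg_surrogateExp_le {d : ℕ} {η : ℝ} {x g u : Vec d}
    (h : |η * inner ℝ g (x - u)| ≤ 1 / 2) :
    Real.exp (-surrogateExp η x g u) ≤ 1 + η * inner ℝ g (x - u) := by
  refine le_trans (le_of_eq ?_) (exp_sub_sq_le_one_add (abs_le.1 h).1)
  rw [surrogateExp]; ring_nf

theorem exp_neg_surrogateStrong_le {d : ℕ} {G η : ℝ} {x g u : Vec d} (hg : ‖g‖ ≤ G)
    (h : |η * inner ℝ g (x - u)| ≤ 1 / 2) :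
    Real.exp (-surrogateStrong G η x g u) ≤ 1 + η * inner ℝ g (x - u) := by
  refine le_trans (Real.exp_le_exp.2 ?_) (exp_sub_sq_le_one_add (abs_le.1 h).1)
  have h1 : (inner ℝ g (x - u) : ℝ) ^ 2 ≤ G ^ 2 * ‖x - u‖ ^ 2 := by
    rw [← mul_pow, sq_le_sq]
    exact (abs_real_inner_le_norm g (x - u)).trans
      ((mul_le_mul_of_nonneg_right hg (norm_nonneg _)).trans (le_abs_self _))
  have h2 := mul_le_mul_of_nonneg_left h1 (sq_nonneg η)
  rw [surrogateStrong]
  linarith [mul_pow η (inner ℝ g (x - u) : ℝ) 2]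

theorem exp_neg_surrogateConv_le {d : ℕ} {G D η : ℝ} {x g u : Vec d}
    (hb : |inner ℝ g (x - u)| ≤ G * D) (h : |η * inner ℝ g (x - u)| ≤ 1 / 2) :
    Real.exp (-surrogateConv G D η x g u) ≤ 1 + η * inner ℝ g (x - u) := by
  refine le_trans (Real.exp_le_exp.2 ?_) (exp_sub_sq_le_one_add (abs_le.1 h).1)
  have h1 : (inner ℝ g (x - u) : ℝ) ^ 2 ≤ (G * D) ^ 2 := by
    rw [sq_le_sq]; exact hb.trans (le_abs_self _)
  have h2 := mul_le_mul_of_nonneg_left h1 (sq_nonneg η)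
  rw [surrogateConv]
  linarith [mul_pow η (inner ℝ g (x - u) : ℝ) 2, mul_pow η (G * D) 2, mul_assoc η G D]

/-! ### Tilted exponential weights -/

theorem normalized_weights {ι : Type*} [Fintype ι] {W L : ℕ → ι → ℝ} (hpos : ∀ i, 0 < W 0 i)
    (hsum : ∑ i, W 0 i = 1)
    (hW : ∀ t i, W (t + 1) i = W t i * Real.exp (-L t i) / ∑ j, W t j * Real.exp (-L t j)) (t : ℕ) :
    (∀ i, 0 < W t i) ∧ ∑ i, W t i = 1 := by
  induction t with
  | zero => exact ⟨hpos, hsum⟩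
  | succ t ih =>
    have hne : (Finset.univ : Finset ι).Nonempty := by
      by_contra h
      rw [Finset.not_nonempty_iff_eq_empty] at h
      simp [h] at hsum
    have hΦ : 0 < ∑ j, W t j * Real.exp (-L t j) :=
      Finset.sum_pos (fun j _ => mul_pos (ih.1 j) (Real.exp_pos _)) hne
    refine ⟨fun i => ?_, ?_⟩
    · rw [hW]; exact div_pos (mul_pos (ih.1 i) (Real.exp_pos _)) hΦ
    · simp only [hW, ← Finset.sum_div]
      exact div_self hΦ.ne'

theorem tilted_mean_mem {d : ℕ} {ι : Type*} [Fintype ι] {X : Set (Vec d)} (hconv : Convex ℝ X)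
    {W ρ : ι → ℝ} (hW : ∀ i, 0 < W i) (hsum : ∑ i, W i = 1) (hρ : ∀ i, 0 < ρ i) {z : ι → Vec d}
    (hz : ∀ i, z i ∈ X) : (∑ i, W i * ρ i)⁻¹ • ∑ i, (W i * ρ i) • z i ∈ X := by
  refine hconv.centerMass_mem (w := fun i => W i * ρ i) (fun i _ => (mul_pos (hW i) (hρ i)).le) ?_
    fun i _ => hz i
  refine Finset.sum_pos (fun i _ => mul_pos (hW i) (hρ i)) ?_
  by_contra h
  rw [Finset.not_nonempty_iff_eq_empty] at h
  simp [h] at hsum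

/-- If the point `x t` is the tilted mean of the predictions, the normalizing constants of the
weights are at most `1`: the linear terms in the bounds on `exp (-L t i)` cancel. Hence no expert
is beaten by more than the logarithm of its inverse prior weight. -/
theorem neg_sum_loss_le_neg_log {d T : ℕ} {ι : Type*} [Fintype ι] {W L : ℕ → ι → ℝ} {ρ : ι → ℝ}
    {x g : ℕ → Vec d} {z : ℕ → ι → Vec d} (hpos : ∀ i, 0 < W 0 i) (hsum : ∑ i, W 0 i = 1)
    (hW : ∀ t i, W (t + 1) i = W t i * Real.exp (-L t i) / ∑ j, W t j * Real.exp (-L t j))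
    (hρ : ∀ i, 0 < ρ i)
    (hx : ∀ t < T, x t = (∑ i, W t i * ρ i)⁻¹ • ∑ i, (W t i * ρ i) • z t i)
    (hL : ∀ t < T, ∀ i, Real.exp (-L t i) ≤ 1 + ρ i * inner ℝ (g t) (x t - z t i)) (i : ι) :
    -∑ t ∈ Finset.range T, L t i ≤ -Real.log (W 0 i) := by
  have hw := normalized_weights hpos hsum hW
  have hΦ : ∀ t < T, ∑ j, W t j * Real.exp (-L t j) ≤ 1 := by
    intro t ht
    have hR : 0 < ∑ j, W t j * ρ j :=
      Finset.sum_pos (fun j _ => mul_pos ((hw t).1 j) (hρ j)) ⟨i, Finset.mem_univ i⟩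
    have hcancel : ∑ j, W t j * (ρ j * inner ℝ (g t) (x t - z t j)) = 0 := by
      have h1 : ∑ j, (W t j * ρ j) • (x t - z t j) = 0 := by
        simp only [smul_sub, Finset.sum_sub_distrib, ← Finset.sum_smul]
        rw [hx t ht, smul_inv_smul₀ hR.ne', sub_self]
      have h2 := congrArg (fun y => (inner ℝ (g t) y : ℝ)) h1
      simpa [inner_sum, inner_smul_right, mul_assoc] using h2
    calc ∑ j, W t j * Real.exp (-L t j)
        ≤ ∑ j, W t j * (1 + ρ j * inner ℝ (g t) (x t - z t j)) :=
          Finset.sum_le_sum fun j _ => mul_le_mul_of_nonneg_left (hL t ht j) ((hw t).1 j).le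
      _ = 1 := by simp only [mul_add, Finset.sum_add_distrib, hcancel, mul_one, (hw t).2, add_zero]
  -- Dividing by normalizing constants of at most `1` only increases the weights.
  have hlow : ∀ n ≤ T, W 0 i * Real.exp (-∑ t ∈ Finset.range n, L t i) ≤ W n i := by
    intro n
    induction n with
    | zero => intro _; simp
    | succ n ih =>
      intro hn
      have h1 : 0 < ∑ j, W n j * Real.exp (-L n j) :=
        Finset.sum_pos (fun j _ => mul_pos ((hw n).1 j) (Real.exp_pos _)) ⟨i, Finset.mem_univ i⟩
      rw [Finset.sum_range_succ, neg_add, Real.exp_add, ← mul_assoc, hW]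
      refine (mul_le_mul_of_nonneg_right (ih (by omega)) (Real.exp_pos _).le).trans ?_
      exact le_div_self (mul_pos ((hw n).1 i) (Real.exp_pos _)).le h1 (hΦ n (by omega))
  have hone : W T i ≤ 1 := by
    rw [← (hw T).2]
    exact Finset.single_le_sum (fun j _ => ((hw T).1 j).le) (Finset.mem_univ i)
  have h2 := Real.log_le_log (mul_pos (hpos i) (Real.exp_pos _)) ((hlow T le_rfl).trans hone)
  rw [Real.log_mul (hpos i).ne' (Real.exp_pos _).ne', Real.log_exp, Real.log_one] at h2
  linarith

/-! ### The grid of learning rates and its prior -/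

theorem le_four_pow_gridTop {T : ℕ} (hT : 0 < T) : (T : ℝ) ≤ 4 ^ gridTop T := by
  have hT' : (0 : ℝ) < T := by exact_mod_cast hT
  have h1 : Real.logb 2 T ≤ ((2 * gridTop T : ℕ) : ℝ) := by
    have := Nat.le_ceil ((1 / 2 : ℝ) * Real.logb 2 T)
    push_cast
    rw [gridTop]
    linarith
  rw [Real.logb_le_iff_le_rpow one_lt_two hT', Real.rpow_natCast, pow_mul] at h1
  norm_num at h1
  exact h1

theorem four_pow_gridTop_le {T : ℕ} (hT : 0 < T) : (4 : ℝ) ^ gridTop T ≤ 4 * T := by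
  have hT' : (0 : ℝ) < T := by exact_mod_cast hT
  have h0 : 0 ≤ (1 / 2 : ℝ) * Real.logb 2 T :=
    mul_nonneg (by norm_num) (Real.logb_nonneg one_lt_two (by exact_mod_cast hT))
  have h1 : ((2 * gridTop T : ℕ) : ℝ) ≤ Real.logb 2 (4 * T) := by
    have h2 := Nat.ceil_lt_add_one h0
    have h3 : Real.logb 2 4 = 2 := by
      rw [show (4 : ℝ) = 2 ^ (2 : ℝ) by norm_num]
      exact Real.logb_rpow two_pos (by norm_num)
    rw [Real.logb_mul (by norm_num) hT'.ne', h3]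
    push_cast
    rw [gridTop]
    linarith
  rw [Real.le_logb_iff_rpow_le one_lt_two (by positivity), Real.rpow_natCast, pow_mul] at h1
  norm_num at h1
  exact h1

theorem prior_pos (T i : ℕ) : 0 < prior T i := by
  rw [prior]; positivity

theorem sum_prior (T : ℕ) : ∑ i : Fin (gridTop T + 1), prior T i = 1 := by
  have h : ∀ n : ℕ, ∑ i ∈ Finset.range n, 1 / (((i : ℝ) + 1) * ((i : ℝ) + 2)) = n / (n + 1) := by
    intro n
    induction n with
    | zero => simp
    | succ n ih => rw [Finset.sum_range_succ, ih]; push_cast; field_simp; ring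
  rw [Fin.sum_univ_eq_sum_range (fun i => prior T i)]
  simp only [prior]
  have h2 := h (gridTop T + 1)
  simp only [div_eq_mul_one_div (1 + 1 / (1 + (gridTop T : ℝ))),
    ← Finset.mul_sum, h2]
  push_cast
  field_simp
  ring

theorem neg_log_prior_le {T : ℕ} (hT : 2 ≤ T) {i : ℕ} (hi : i ≤ gridTop T) :
    -Real.log (prior T i) ≤ 4 * Real.log T := by
  have hT' : (2 : ℝ) ≤ T := by exact_mod_cast hT
  rw [← Real.log_inv, ← Real.log_rpow (by linarith) 4]
  apply Real.log_le_log (inv_pos.2 (prior_pos T i))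
  have h1 : (prior T i)⁻¹ ≤ ((i : ℝ) + 1) * ((i : ℝ) + 2) := by
    rw [prior, inv_div]
    exact div_le_self (by positivity) (le_add_of_nonneg_right (by positivity))
  have h2 : (i : ℝ) + 1 ≤ 2 ^ i := by exact_mod_cast Nat.lt_two_pow_self
  have h3 : (2 : ℝ) ^ i * 2 ^ i ≤ 4 * T := by
    rw [← mul_pow]
    norm_num
    exact (pow_le_pow_right₀ (by norm_num) hi).trans (four_pow_gridTop_le (by omega))
  have h4 : ((i : ℝ) + 1) * ((i : ℝ) + 2) ≤ 2 ^ i * (2 * 2 ^ i) :=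
    mul_le_mul h2 (by linarith [one_le_pow₀ (M₀ := ℝ) one_le_two (n := i)]) (by positivity)
      (by positivity)
  have h5 : (8 : ℝ) * T ≤ T ^ (4 : ℝ) := by
    rw [show (4 : ℝ) = (4 : ℕ) by norm_num, Real.rpow_natCast]
    nlinarith [pow_le_pow_left₀ two_pos.le hT' 3]
  linarith

theorem rate_pos {G D : ℝ} (hG : 0 < G) (hD : 0 < D) (i : ℕ) : 0 < rate G D i := by
  rw [rate]; positivity

theorem rate_mul_le {G D : ℝ} (hG : 0 < G) (hD : 0 < D) (i : ℕ) :
    rate G D i * (G * D) ≤ 1 / 5 := by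
  have h : rate G D i * (G * D) = 1 / 5 * (1 / 2 ^ i) := by rw [rate]; field_simp
  rw [h]
  refine mul_le_of_le_one_right (by norm_num) ?_
  rw [div_le_one (by positivity)]
  exact one_le_pow₀ one_le_two

/-! ### Consequences of the standing assumptions -/

section Instance

variable {d T : ℕ} {X : Set (Vec d)} {G D : ℝ} {f : ℕ → Loss d}

theorem IsOCOInstance.isCompact (hI : IsOCOInstance X G D T f) : IsCompact X := by
  refine Metric.isCompact_of_isClosed_isBounded hI.closed (Metric.isBounded_iff.2 ⟨D, ?_⟩)
  intro x hx y hy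
  rw [dist_eq_norm]
  exact hI.dist_le x hx y hy

theorem IsOCOInstance.abs_inner_le (hI : IsOCOInstance X G D T f) {t : ℕ} (ht : t < T)
    {x y z : Vec d} (hx : x ∈ X) (hy : y ∈ X) (hz : z ∈ X) :
    |inner ℝ ((f t).grad x) (y - z)| ≤ G * D :=
  (abs_real_inner_le_norm _ _).trans
    (mul_le_mul (hI.grad_le t ht x hx) (hI.dist_le y hy z hz) (norm_nonneg _) hI.G_pos.le)

theorem IsOCOInstance.abs_rate_mul_inner_le (hI : IsOCOInstance X G D T f) {t : ℕ} (ht : t < T)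
    {x y z : Vec d} (hx : x ∈ X) (hy : y ∈ X) (hz : z ∈ X) (i : ℕ) :
    |rate G D i * inner ℝ ((f t).grad x) (y - z)| ≤ 1 / 5 := by
  rw [abs_mul, abs_of_pos (rate_pos hI.G_pos hI.D_pos i)]
  exact (mul_le_mul_of_nonneg_left (hI.abs_inner_le ht hx hy hz)
    (rate_pos hI.G_pos hI.D_pos i).le).trans (rate_mul_le hI.G_pos hI.D_pos i)

end Instance

theorem neg_sum_surrogateExp {d : ℕ} (T : ℕ) (η : ℝ) (x g : ℕ → Vec d) (u : Vec d) :
    -∑ t ∈ Finset.range T, surrogateExp η (x t) (g t) u =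
      η * ∑ t ∈ Finset.range T, inner ℝ (g t) (x t - u) -
        η ^ 2 * ∑ t ∈ Finset.range T, (inner ℝ (g t) (x t - u)) ^ 2 := by
  simp only [surrogateExp, Finset.sum_add_distrib, ← Finset.mul_sum]
  ring

/-! ### MetaGrad -/

section MetaGrad

variable {d T : ℕ} {X : Set (Vec d)} {G D : ℝ} {f : ℕ → Loss d} {x₁ : Vec d}

theorem metaGrad_point_mem (hI : IsOCOInstance X G D T f) (hx₁ : x₁ ∈ X) (t : ℕ)
    (i : Fin (gridTop T + 1)) : ((metaGrad X G D T x₁).stateAt f t).point i ∈ X := by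
  cases t with
  | zero => exact hx₁
  | succ t => exact (proj_spec hI.isCompact hI.nonempty _ _).1

theorem metaGrad_weight (t : ℕ) :
    (∀ i, 0 < ((metaGrad X G D T x₁).stateAt f t).weight i) ∧
      ∑ i, ((metaGrad X G D T x₁).stateAt f t).weight i = 1 :=
  normalized_weights (W := fun t => ((metaGrad X G D T x₁).stateAt f t).weight)
    (L := fun t i => surrogateExp (rate G D i) ((metaGrad X G D T x₁).play f t)
      ((f t).grad ((metaGrad X G D T x₁).play f t))
      (((metaGrad X G D T x₁).stateAt f t).point i))
    (fun i => prior_pos T i) (sum_prior T) (fun _ _ => rfl) t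

theorem metaGrad_play_mem (hI : IsOCOInstance X G D T f) (hx₁ : x₁ ∈ X) (t : ℕ) :
    (metaGrad X G D T x₁).play f t ∈ X :=
  tilted_mean_mem hI.convex (metaGrad_weight t).1 (metaGrad_weight t).2
    (fun i => rate_pos hI.G_pos hI.D_pos i) (metaGrad_point_mem hI hx₁ t)

/-- The surrogate loss of a slave of MetaGrad at a fixed point `u`. The slave takes Newton steps in
the direction `√2 η g`, so that the quadratic gain equals the curvature of `2 ℓ^η`. -/
theorem metaGrad_surrogate_le (hd : 0 < d) (hT : 2 ≤ T) (hI : IsOCOInstance X G D T f)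
    (hx₁ : x₁ ∈ X) {u : Vec d} (hu : u ∈ X) {i : ℕ} (hi : i ≤ gridTop T) :
    rate G D i * ∑ t ∈ Finset.range T, inner ℝ ((f t).grad ((metaGrad X G D T x₁).play f t))
        ((metaGrad X G D T x₁).play f t - u) -
      rate G D i ^ 2 * ∑ t ∈ Finset.range T,
        (inner ℝ ((f t).grad ((metaGrad X G D T x₁).play f t))
          ((metaGrad X G D T x₁).play f t - u)) ^ 2 ≤ 10 * (d * Real.log T) := by
  have hG := hI.G_pos
  have hD := hI.D_pos
  set j : Fin (gridTop T + 1) := ⟨i, by omega⟩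
  set s : ℕ → MetaGradState d T := (metaGrad X G D T x₁).stateAt f
  set x := (metaGrad X G D T x₁).play f
  have hxX : ∀ t, x t ∈ X := metaGrad_play_mem hI hx₁
  have hpX : ∀ t k, (s t).point k ∈ X := metaGrad_point_mem hI hx₁
  set η := rate G D i with hη
  have hηpos : 0 < η := rate_pos hG hD i
  have hmeta := neg_sum_loss_le_neg_log (T := T) (W := fun t => (s t).weight)
    (L := fun t k => surrogateExp (rate G D k) (x t) ((f t).grad (x t)) ((s t).point k))
    (ρ := fun k => rate G D k) (x := x) (g := fun t => (f t).grad (x t))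
    (z := fun t => (s t).point) (fun k => prior_pos T k) (sum_prior T) (fun _ _ => rfl)
    (fun k => rate_pos hG hD k) (fun _ _ => rfl)
    (fun t ht k => exp_neg_surrogateExp_le
      ((hI.abs_rate_mul_inner_le ht (hxX t) (hxX t) (hpX t k) k).trans (by norm_num))) j
  have hprior : -Real.log ((s 0).weight j) ≤ 4 * Real.log T := neg_log_prior_le hT hi
  have hsq2 : Real.sqrt 2 ^ 2 = 2 := Real.sq_sqrt (by norm_num)
  have hslave := newton_regret (T := T) hd hI.isCompact hI.convex (D := D) (B := 1) (c := 1)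
    (p := 1 / D ^ 2) (by positivity) (P := fun t => metaGradPrecision D η (s t).gram)
    (h := fun t => (Real.sqrt 2 * η) • (f t).grad (x t))
    (v := fun t => (η * (1 + 2 * η * inner ℝ ((f t).grad (x t)) ((s t).point j - x t))) •
      (f t).grad (x t))
    (w := fun t => (s t).point j)
    (b := fun t => (1 + 2 * η * inner ℝ ((f t).grad (x t)) ((s t).point j - x t)) / Real.sqrt 2)
    (by show metaGradPrecision D η 0 = _
        simp [metaGradPrecision])
    (fun t => by
      show metaGradPrecision D η ((s t).gram + outer ((f t).grad (x t))) = _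
      rw [outer_smul, mul_pow, hsq2, metaGradPrecision, metaGradPrecision, smul_add, add_assoc])
    (fun t => by
      rw [map_smul, one_smul]
      rfl)
    (fun t ht => by
      rw [smul_smul]
      congr 1
      field_simp)
    (fun t ht => by
      rw [div_pow, hsq2, div_le_one two_pos]
      have h1 := abs_le.1 (hI.abs_rate_mul_inner_le ht (hxX t) (hpX t j) (hxX t) i)
      rw [← hη] at h1
      nlinarith [h1.1, h1.2])
    (fun t ht => by
      have h1 : η * (G * D) ≤ 1 / 5 := rate_mul_le hG hD i
      have h2 : ‖(f t).grad (x t)‖ ^ 2 ≤ G ^ 2 :=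
        pow_le_pow_left₀ (norm_nonneg _) (hI.grad_le t ht _ (hxX t)) 2
      have h3 : (η * (G * D)) ^ 2 ≤ (1 / 5) ^ 2 := pow_le_pow_left₀ (by positivity) h1 2
      rw [norm_smul, mul_pow, Real.norm_eq_abs, sq_abs, mul_pow, hsq2, le_div_iff₀ (by positivity)]
      calc 2 * η ^ 2 * ‖(f t).grad (x t)‖ ^ 2 * D ^ 2 ≤ 2 * η ^ 2 * G ^ 2 * D ^ 2 := by gcongr
        _ = 2 * (η * (G * D)) ^ 2 := by ring
        _ ≤ 1 := by linarith)
    hu (hI.dist_le _ (hpX 0 j) _ hu)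
  have hterm : ∀ t, 2 * 1 * (inner ℝ ((η * (1 + 2 * η *
        inner ℝ ((f t).grad (x t)) ((s t).point j - x t))) • (f t).grad (x t))
        ((s t).point j - u) : ℝ) -
      (inner ℝ ((Real.sqrt 2 * η) • (f t).grad (x t)) ((s t).point j - u)) ^ 2 =
      2 * (surrogateExp η (x t) ((f t).grad (x t)) ((s t).point j) -
        surrogateExp η (x t) ((f t).grad (x t)) u) := by
    intro t
    rw [surrogateExp_sub, real_inner_smul_left _ _ (√2 * η), mul_pow, mul_pow, hsq2]
    ring
  simp only [hterm, ← Finset.mul_sum, Finset.sum_sub_distrib] at hslave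
  have hp : 1 / D ^ 2 * D ^ 2 = 1 := by field_simp
  rw [hp] at hslave
  rw [← neg_sum_surrogateExp T η x (fun t => (f t).grad (x t)) u]
  have hlog := mul_le_mul_of_nonneg_left (log_one_add_le_two_mul hT) (Nat.cast_nonneg' (α := ℝ) d)
  have h1 := one_le_two_mul_log hT
  have hd1 : (1 : ℝ) ≤ d := by exact_mod_cast hd
  have h2 : Real.log T ≤ d * Real.log T := le_mul_of_one_le_left (by linarith) hd1
  have hmeta' : -∑ t ∈ Finset.range T, surrogateExp η (x t) ((f t).grad (x t)) ((s t).point j) ≤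
    -Real.log ((s 0).weight j) := hmeta
  linarith

end MetaGrad

/-! ### Maler -/

/-- The experts of Maler as one index set: the convex expert, the strongly convex experts and the
exp-concave experts, in this order. -/
abbrev MalerIndex (T : ℕ) : Type := Option (Fin (gridTop T + 1) ⊕ Fin (gridTop T + 1))

/-- The predictions of all experts of Maler. -/
def MalerState.allPoints {d T : ℕ} (s : MalerState d T) : MalerIndex T → Vec d
  | none => s.pointC
  | some (Sum.inl i) => s.pointS i
  | some (Sum.inr i) => s.pointE i

/-- The weights of all experts of Maler. -/
def MalerState.allWeights {d T : ℕ} (s : MalerState d T) : MalerIndex T → ℝ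
  | none => s.weightC
  | some (Sum.inl i) => s.weightS i
  | some (Sum.inr i) => s.weightE i

/-- The learning rates of all experts of Maler. -/
noncomputable def malerAllRates (G D : ℝ) (T : ℕ) : MalerIndex T → ℝ
  | none => malerRateC G D T
  | some (Sum.inl i) => rate G D i
  | some (Sum.inr i) => rate G D i

/-- The surrogate losses of all experts of Maler. -/
noncomputable def malerAllSurrogates {d : ℕ} (G D : ℝ) (T : ℕ) (x g : Vec d) :
    MalerIndex T → Vec d → ℝ
  | none => surrogateConv G D (malerRateC G D T) x g
  | some (Sum.inl i) => surrogateStrong G (rate G D i) x g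
  | some (Sum.inr i) => surrogateExp (rate G D i) x g

section Maler

variable {d T : ℕ} {X : Set (Vec d)} {G D : ℝ} {f : ℕ → Loss d} {x₁ : Vec d}

theorem sum_malerIndex {M : Type*} [AddCommMonoid M] (a : MalerIndex T → M) :
    ∑ o, a o = a none + ∑ i, (a (some (Sum.inl i)) + a (some (Sum.inr i))) := by
  rw [Fintype.sum_option, Fintype.sum_sum_type, Finset.sum_add_distrib]

theorem malerAllRates_pos (hT : 2 ≤ T) (hG : 0 < G) (hD : 0 < D) (o : MalerIndex T) :
    0 < malerAllRates G D T o := by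
  have hT' : (0 : ℝ) < T := by exact_mod_cast (by omega : 0 < T)
  rcases o with _ | i | i
  · show 0 < malerRateC G D T
    rw [malerRateC]; positivity
  · exact rate_pos hG hD i
  · exact rate_pos hG hD i

theorem maler_action_eq (s : MalerState d T) :
    s.action G D = (∑ o, s.allWeights o * malerAllRates G D T o)⁻¹ •
      ∑ o, (s.allWeights o * malerAllRates G D T o) • s.allPoints o := by
  rw [sum_malerIndex, sum_malerIndex]
  rfl

theorem maler_allWeights_succ (t : ℕ) (o : MalerIndex T) :
    MalerState.allWeights ((maler X G D T x₁).stateAt f (t + 1)) o =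
      MalerState.allWeights ((maler X G D T x₁).stateAt f t) o *
        Real.exp (-malerAllSurrogates G D T ((maler X G D T x₁).play f t)
          ((f t).grad ((maler X G D T x₁).play f t)) o
          (MalerState.allPoints ((maler X G D T x₁).stateAt f t) o)) /
      ∑ o, MalerState.allWeights ((maler X G D T x₁).stateAt f t) o *
        Real.exp (-malerAllSurrogates G D T ((maler X G D T x₁).play f t)
          ((f t).grad ((maler X G D T x₁).play f t)) o
          (MalerState.allPoints ((maler X G D T x₁).stateAt f t) o)) := by
  rw [sum_malerIndex]
  rcases o with _ | i | i <;> rfl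

theorem maler_allWeights_zero_pos (o : MalerIndex T) :
    0 < MalerState.allWeights ((maler X G D T x₁).stateAt f 0) o := by
  rcases o with _ | i | i
  · show (0 : ℝ) < 1 / 3
    norm_num
  · exact div_pos (prior_pos T i) three_pos
  · exact div_pos (prior_pos T i) three_pos

theorem sum_maler_allWeights_zero :
    ∑ o, MalerState.allWeights ((maler X G D T x₁).stateAt f 0) o = 1 := by
  rw [sum_malerIndex]
  show (1 / 3 : ℝ) + ∑ i : Fin (gridTop T + 1), (prior T i / 3 + prior T i / 3) = 1
  rw [Finset.sum_add_distrib, ← Finset.sum_div, sum_prior]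
  norm_num

theorem maler_allPoints_mem (hI : IsOCOInstance X G D T f) (hx₁ : x₁ ∈ X) (t : ℕ)
    (o : MalerIndex T) : MalerState.allPoints ((maler X G D T x₁).stateAt f t) o ∈ X := by
  cases t with
  | zero => rcases o with _ | i | i <;> exact hx₁
  | succ t => rcases o with _ | i | i <;> exact (proj_spec hI.isCompact hI.nonempty _ _).1

theorem maler_play_mem (hT : 2 ≤ T) (hI : IsOCOInstance X G D T f) (hx₁ : x₁ ∈ X) (t : ℕ) :
    (maler X G D T x₁).play f t ∈ X := by
  have hw := normalized_weights
    (W := fun t => MalerState.allWeights ((maler X G D T x₁).stateAt f t))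
    (L := fun t o => malerAllSurrogates G D T ((maler X G D T x₁).play f t)
      ((f t).grad ((maler X G D T x₁).play f t)) o
      (MalerState.allPoints ((maler X G D T x₁).stateAt f t) o))
    maler_allWeights_zero_pos sum_maler_allWeights_zero maler_allWeights_succ t
  have h : (maler X G D T x₁).play f t = _ := maler_action_eq _
  rw [h]
  exact tilted_mean_mem hI.convex hw.1 hw.2 (malerAllRates_pos hT hI.G_pos hI.D_pos)
    (maler_allPoints_mem hI hx₁ t)

theorem exp_neg_malerAllSurrogates_le (hT : 2 ≤ T) (hI : IsOCOInstance X G D T f) {t : ℕ}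
    (ht : t < T) {x z : Vec d} (hx : x ∈ X) (hz : z ∈ X) (o : MalerIndex T) :
    Real.exp (-malerAllSurrogates G D T x ((f t).grad x) o z) ≤
      1 + malerAllRates G D T o * inner ℝ ((f t).grad x) (x - z) := by
  have hrate := fun i => (hI.abs_rate_mul_inner_le ht hx hx hz i).trans
    (by norm_num : (1 / 5 : ℝ) ≤ 1 / 2)
  rcases o with _ | i | i
  · have hG := hI.G_pos
    have hD := hI.D_pos
    have hsqrt : 1 ≤ Real.sqrt T := Real.one_le_sqrt.2 (by exact_mod_cast (by omega : 1 ≤ T))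
    have hb := hI.abs_inner_le ht hx hx hz
    have hpos : 0 < malerRateC G D T := malerAllRates_pos hT hG hD none
    refine exp_neg_surrogateConv_le hb ?_
    rw [abs_mul, abs_of_pos hpos]
    refine (mul_le_mul_of_nonneg_left hb hpos.le).trans ?_
    have h : malerRateC G D T * (G * D) = 1 / (2 * Real.sqrt T) := by
      rw [malerRateC]; field_simp
    rw [h]
    exact one_div_le_one_div_of_le two_pos (by linarith)
  · exact exp_neg_surrogateStrong_le (hI.grad_le t ht x hx) (hrate i)
  · exact exp_neg_surrogateExp_le (hrate i)

/-- The surrogate loss of an exp-concave expert of Maler at a fixed point `u`. Here the direction of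
the Newton step is the surrogate gradient itself, and the step size is `1 / β = 2`. -/
theorem maler_surrogate_le (hd : 0 < d) (hT : 2 ≤ T) (hI : IsOCOInstance X G D T f)
    (hx₁ : x₁ ∈ X) {u : Vec d} (hu : u ∈ X) {i : ℕ} (hi : i ≤ gridTop T) :
    rate G D i * ∑ t ∈ Finset.range T, inner ℝ ((f t).grad ((maler X G D T x₁).play f t))
        ((maler X G D T x₁).play f t - u) -
      rate G D i ^ 2 * ∑ t ∈ Finset.range T,
        (inner ℝ ((f t).grad ((maler X G D T x₁).play f t))
          ((maler X G D T x₁).play f t - u)) ^ 2 ≤ 10 * (d * Real.log T) := by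
  have hG := hI.G_pos
  have hD := hI.D_pos
  set j : Fin (gridTop T + 1) := ⟨i, by omega⟩
  have hxX : ∀ t, (maler X G D T x₁).play f t ∈ X := maler_play_mem hT hI hx₁
  have hpX := maler_allPoints_mem (f := f) hI hx₁
  have hmeta := neg_sum_loss_le_neg_log (T := T)
    (W := fun t => MalerState.allWeights ((maler X G D T x₁).stateAt f t))
    (L := fun t o => malerAllSurrogates G D T ((maler X G D T x₁).play f t)
      ((f t).grad ((maler X G D T x₁).play f t)) o
      (MalerState.allPoints ((maler X G D T x₁).stateAt f t) o))
    (x := (maler X G D T x₁).play f)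
    (g := fun t => (f t).grad ((maler X G D T x₁).play f t))
    (z := fun t => MalerState.allPoints ((maler X G D T x₁).stateAt f t))
    maler_allWeights_zero_pos sum_maler_allWeights_zero maler_allWeights_succ
    (malerAllRates_pos hT hG hD) (fun t _ => maler_action_eq _)
    (fun t ht o => exp_neg_malerAllSurrogates_le hT hI ht (hxX t) (hpX t o) o)
    (some (Sum.inr j))
  set s : ℕ → MalerState d T := (maler X G D T x₁).stateAt f
  set x := (maler X G D T x₁).play f
  set η := rate G D i with hη
  have hηpos : 0 < η := rate_pos hG hD i
  have hpX' : ∀ t, (s t).pointE j ∈ X := fun t => hpX t (some (Sum.inr j))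
  have hprior : -Real.log ((s 0).allWeights (some (Sum.inr j))) ≤
      4 * Real.log T + 2 * Real.log T := by
    show -Real.log (prior T i / 3) ≤ _
    have hT' : (2 : ℝ) ≤ T := by exact_mod_cast hT
    have h3 : Real.log 3 ≤ 2 * Real.log T := by
      rw [← Real.log_rpow (by linarith) 2]
      apply Real.log_le_log three_pos
      rw [Real.rpow_two]
      nlinarith
    rw [Real.log_div (prior_pos T i).ne' three_ne_zero]
    linarith [neg_log_prior_le hT hi]
  have hz : ∀ t < T, |1 + 2 * η * inner ℝ ((f t).grad (x t)) ((s t).pointE j - x t)| ≤ 7 / 5 := by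
    intro t ht
    have h1 := abs_le.1 (hI.abs_rate_mul_inner_le ht (hxX t) (hpX' t) (hxX t) i)
    rw [← hη] at h1
    rw [abs_le]
    constructor <;> nlinarith [h1.1, h1.2]
  have hz2 : ∀ t < T, (1 + 2 * η * inner ℝ ((f t).grad (x t)) ((s t).pointE j - x t)) ^ 2 ≤
      49 / 25 := fun t ht =>
    (sq_le_sq.2 ((hz t ht).trans (le_abs_self _))).trans_eq (by norm_num)
  set v : ℕ → Vec d := fun t =>
    (η * (1 + 2 * η * inner ℝ ((f t).grad (x t)) ((s t).pointE j - x t))) • (f t).grad (x t)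
    with hv
  have hgrad : ∀ t, gradient (surrogateExp η (x t) ((f t).grad (x t))) ((s t).pointE j) = v t :=
    fun t => gradient_surrogateExp _ _ _ _
  have hslave := newton_regret (T := T) hd hI.isCompact hI.convex (D := D) (B := 1) (c := 2)
    (p := 1 / ((1 / 2 : ℝ) ^ 2 * D ^ 2)) (by positivity) (P := fun t => (s t).sigmaE j)
    (h := v) (v := v) (w := fun t => (s t).pointE j) (b := fun _ => 1) rfl
    (fun t => by
      rw [← hgrad]
      rfl)
    (fun t => by
      rw [← hgrad, show (2 : ℝ) = 1 / (1 / 2) by norm_num]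
      rfl)
    (fun t _ => (one_smul _ _).symm) (fun t _ => by norm_num)
    (fun t ht => by
      have h1 : η * (G * D) ≤ 1 / 5 := rate_mul_le hG hD i
      have h2 : ‖(f t).grad (x t)‖ ^ 2 ≤ G ^ 2 :=
        pow_le_pow_left₀ (norm_nonneg _) (hI.grad_le t ht _ (hxX t)) 2
      have h3 : (η * (G * D)) ^ 2 ≤ (1 / 5) ^ 2 := pow_le_pow_left₀ (by positivity) h1 2
      rw [hv, norm_smul, mul_pow, Real.norm_eq_abs, sq_abs, mul_pow, le_div_iff₀ (by positivity)]
      calc _ ≤ η ^ 2 * (49 / 25) * G ^ 2 * ((1 / 2 : ℝ) ^ 2 * D ^ 2) := by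
            gcongr
            exact hz2 t ht
        _ = 49 / 100 * (η * (G * D)) ^ 2 := by ring
        _ ≤ 1 := by linarith)
    hu (hI.dist_le _ (hpX' 0) _ hu)
  -- The curvature of `ℓ^η` dominates a quarter of the squared gradient as `(7 / 5) ^ 2 ≤ 4`.
  have hterm : ∀ t ∈ Finset.range T,
      4 * (surrogateExp η (x t) ((f t).grad (x t)) ((s t).pointE j) -
        surrogateExp η (x t) ((f t).grad (x t)) u) ≤
      2 * 2 * inner ℝ (v t) ((s t).pointE j - u) - inner ℝ (v t) ((s t).pointE j - u) ^ 2 := by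
    intro t ht
    rw [surrogateExp_sub]
    simp only [hv]
    rw [real_inner_smul_left, mul_pow, mul_pow]
    have h1 := mul_le_mul_of_nonneg_left (hz2 t (Finset.mem_range.1 ht))
      (by positivity : 0 ≤ η ^ 2 * (inner ℝ ((f t).grad (x t)) ((s t).pointE j - u) : ℝ) ^ 2)
    have h2 : 0 ≤ η ^ 2 * (inner ℝ ((f t).grad (x t)) ((s t).pointE j - u) : ℝ) ^ 2 := by positivity
    linarith
  have hsum := (Finset.sum_le_sum hterm).trans hslave
  rw [← Finset.mul_sum, Finset.sum_sub_distrib] at hsum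
  have hp : 1 / ((1 / 2 : ℝ) ^ 2 * D ^ 2) * D ^ 2 = 4 := by field_simp; norm_num
  rw [hp] at hsum
  rw [← neg_sum_surrogateExp T η x (fun t => (f t).grad (x t)) u]
  have hlog := mul_le_mul_of_nonneg_left (log_one_add_le_two_mul hT) (Nat.cast_nonneg' (α := ℝ) d)
  have h1 := one_le_two_mul_log hT
  have hd1 : (1 : ℝ) ≤ d := by exact_mod_cast hd
  have h2 : Real.log T ≤ d * Real.log T := le_mul_of_one_le_left (by linarith) hd1
  have hmeta' : -∑ t ∈ Finset.range T, surrogateExp η (x t) ((f t).grad (x t)) ((s t).pointE j) ≤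
    -Real.log ((s 0).allWeights (some (Sum.inr j))) := hmeta
  linarith

end Maler

/-! ### From surrogate bounds to regret -/

/-- Optimizing over the grid: the smallest index `i` whose rate satisfies
`(rate G D i) ^ 2 * V ≤ A` is within a factor `2` of the best rate, unless it is the first one. -/
theorem le_sqrt_of_forall_rate {G D : ℝ} (hG : 0 < G) (hD : 0 < D) {T : ℕ} (hT : 0 < T)
    {R V A : ℝ} (hA : 1 ≤ A) (hV0 : 0 ≤ V) (hV : V ≤ T * (G * D) ^ 2)
    (h : ∀ i ≤ gridTop T, rate G D i * R - rate G D i ^ 2 * V ≤ A) :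
    R ≤ 10 * (G * D) * A + 3 * Real.sqrt (V * A) := by
  -- The last rate qualifies because `V ≤ T (G D)²`.
  have hlast : rate G D (gridTop T) ^ 2 * V ≤ A := by
    have h1 : rate G D (gridTop T) ^ 2 * (4 ^ gridTop T * (G * D) ^ 2) = 1 / 25 := by
      have : (4 : ℝ) ^ gridTop T = (2 ^ gridTop T) ^ 2 := by
        rw [← pow_mul, mul_comm, pow_mul]; norm_num
      rw [this, rate]
      field_simp
      norm_num
    have h2 : V ≤ 4 ^ gridTop T * (G * D) ^ 2 :=
      hV.trans (mul_le_mul_of_nonneg_right (le_four_pow_gridTop hT) (sq_nonneg _))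
    linarith [mul_le_mul_of_nonneg_left h2 (sq_nonneg (rate G D (gridTop T)))]
  have hex : ∃ i, rate G D i ^ 2 * V ≤ A := ⟨_, hlast⟩
  classical
  set i := Nat.find hex with hi
  have hspec : rate G D i ^ 2 * V ≤ A := Nat.find_spec hex
  have hle : i ≤ gridTop T := Nat.find_min' hex hlast
  have hη := rate_pos hG hD i
  have hR : rate G D i * R ≤ rate G D i ^ 2 * V + A := by linarith [h i hle]
  have hs0 := Real.sqrt_nonneg (V * A)
  rcases Nat.eq_zero_or_pos i with h0 | hpos
  · have h1 : rate G D 0 * (10 * (G * D) * A) = 2 * A := by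
      rw [rate]; field_simp; norm_num
    rw [h0] at hR hspec hη
    have h2 : rate G D 0 * R ≤ rate G D 0 * (10 * (G * D) * A) := by linarith
    linarith [le_of_mul_le_mul_left h2 hη]
  · have hprev := Nat.find_min hex (Nat.sub_lt hpos one_pos)
    push Not at hprev
    rw [← hi] at hprev
    have hhalf : rate G D (i - 1) = 2 * rate G D i := by
      obtain ⟨n, hn⟩ : ∃ n, i = n + 1 := ⟨i - 1, by omega⟩
      rw [hn, Nat.add_sub_cancel, rate, rate, pow_succ]
      field_simp
    rw [hhalf] at hprev
    have hA0 : 0 ≤ A := by linarith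
    have hsq : Real.sqrt (V * A) ^ 2 = V * A := Real.sq_sqrt (mul_nonneg hV0 hA0)
    have h1 : rate G D i * V ≤ Real.sqrt (V * A) := by
      apply Real.le_sqrt_of_sq_le
      have := mul_le_mul_of_nonneg_left hspec hV0
      linarith
    have h2 : A ≤ 2 * rate G D i * Real.sqrt (V * A) := by
      have h3 : A ^ 2 ≤ (2 * rate G D i * Real.sqrt (V * A)) ^ 2 := by
        rw [mul_pow, hsq]
        have := mul_le_mul_of_nonneg_left hprev.le hA0
        linarith
      exact le_of_sq_le_sq h3 (by positivity)
    have h4 : rate G D i * R ≤ rate G D i * (3 * Real.sqrt (V * A)) := by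
      have := mul_le_mul_of_nonneg_left h1 hη.le
      linarith
    have h5 : 0 ≤ 10 * (G * D) * A := by positivity
    linarith [le_of_mul_le_mul_left h4 hη]

section Contaminated

variable {d T k : ℕ} {X : Set (Vec d)} {G D α : ℝ} {f : ℕ → Loss d}

theorem gammaConst_pos (hG : 0 < G) (hD : 0 < D) (hα : 0 < α) : 0 < gammaConst G D α := by
  rw [gammaConst]; positivity

theorem gammaConst_mul_le (hG : 0 < G) (hD : 0 < D) : gammaConst G D α * (G * D) ≤ 1 / 2 := by
  have h : gammaConst G D α ≤ 1 / 2 * (1 / (G * D)) :=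
    mul_le_mul_of_nonneg_left (min_le_left _ _) (by norm_num)
  refine (mul_le_mul_of_nonneg_right h (by positivity)).trans_eq ?_
  field_simp

/-- A second-order bound for the linearized losses adapts to contamination. The curvature of the
exp-concave rounds pays for their share of the quadratic variation, and the contaminated rounds
add at most `(G D)²` each to the variation. -/
theorem sum_sub_le_of_second_order (hI : IsOCOInstance X G D T f) (hα : 0 < α)
    (hcont : IsContaminated (IsExpConcave α X) k T f) {x u : ℕ → Vec d} (hx : ∀ t < T, x t ∈ X)
    (hu : ∀ t < T, u t ∈ X) {a b A : ℝ} (ha : 0 ≤ a) (hb : 0 ≤ b) (hA : 0 ≤ A)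
    (h : ∑ t ∈ Finset.range T, inner ℝ ((f t).grad (x t)) (x t - u t) ≤ a * (G * D) * A +
      b * Real.sqrt ((∑ t ∈ Finset.range T, (inner ℝ ((f t).grad (x t)) (x t - u t)) ^ 2) * A)) :
    ∑ t ∈ Finset.range T, ((f t).val (x t) - (f t).val (u t)) ≤
      (a + b ^ 2) / 2 * (A / gammaConst G D α) + b * (G * D) * Real.sqrt (k * A) := by
  have hG := hI.G_pos
  have hD := hI.D_pos
  obtain ⟨I, hIT, hIk, hexp⟩ := hcont
  set γ := gammaConst G D α with hγ
  have hγpos : 0 < γ := gammaConst_pos hG hD hα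
  have hγle : γ * (G * D) ≤ 1 / 2 := gammaConst_mul_le hG hD
  set p : ℕ → ℝ := fun t => inner ℝ ((f t).grad (x t)) (x t - u t) with hp
  set VE := ∑ t ∈ Finset.range T \ I, p t ^ 2 with hVE
  have hVE0 : 0 ≤ VE := Finset.sum_nonneg fun _ _ => sq_nonneg _
  have hsplit : ∑ t ∈ Finset.range T, p t ^ 2 ≤ VE + k * (G * D) ^ 2 := by
    rw [← Finset.sum_sdiff hIT, ← hIk, ← nsmul_eq_mul]
    refine add_le_add le_rfl (Finset.sum_le_card_nsmul _ _ _ fun t ht => ?_)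
    have htT := Finset.mem_range.1 (hIT ht)
    rw [sq_le_sq]
    exact (hI.abs_inner_le htT (hx t htT) (hx t htT) (hu t htT)).trans (le_abs_self _)
  have hloss : ∑ t ∈ Finset.range T, ((f t).val (x t) - (f t).val (u t)) ≤
      ∑ t ∈ Finset.range T, p t - γ / 2 * VE := by
    rw [← Finset.sum_sdiff hIT, ← Finset.sum_sdiff hIT (f := p), hVE, Finset.mul_sum]
    have h1 : ∑ t ∈ Finset.range T \ I, ((f t).val (x t) - (f t).val (u t)) ≤
        ∑ t ∈ Finset.range T \ I, (p t - γ / 2 * p t ^ 2) := by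
      refine Finset.sum_le_sum fun t ht => ?_
      have htT := Finset.mem_range.1 (Finset.mem_sdiff.1 ht).1
      exact IsExpConcave.sub_le hG hD hα (hexp t ht) (hx t htT) (hu t htT)
        (hI.hasGradient t htT _ (hx t htT)) (hI.abs_inner_le htT (hx t htT) (hx t htT) (hu t htT))
    have h2 : ∑ t ∈ I, ((f t).val (x t) - (f t).val (u t)) ≤ ∑ t ∈ I, p t := by
      refine Finset.sum_le_sum fun t ht => ?_
      have htT := Finset.mem_range.1 (hIT ht)
      have h3 := inner_gradientWithin_le_sub (hI.convexOn t htT) (hx t htT) (hu t htT)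
        (hI.hasGradient t htT _ (hx t htT))
      rw [← neg_sub (x t) (u t), inner_neg_right] at h3
      simp only [hp]
      linarith
    rw [Finset.sum_sub_distrib p] at h1
    linarith
  have hsqrt : Real.sqrt ((∑ t ∈ Finset.range T, p t ^ 2) * A) ≤
      Real.sqrt (VE * A) + G * D * Real.sqrt (k * A) := by
    have h1 : (∑ t ∈ Finset.range T, p t ^ 2) * A ≤ VE * A + (G * D) ^ 2 * (k * A) := by
      linarith [mul_le_mul_of_nonneg_right hsplit hA]
    have h2 : Real.sqrt ((G * D) ^ 2 * (k * A)) = G * D * Real.sqrt (k * A) := by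
      rw [Real.sqrt_mul (sq_nonneg _), Real.sqrt_sq (by positivity)]
    rw [← h2]
    exact (Real.sqrt_le_sqrt h1).trans 
      (sqrt_add_le_sqrt_add_sqrt (by positivity) (by positivity))
  -- Young's inequality lets the curvature of the exp-concave rounds absorb their variation.
  have hyoung : b * Real.sqrt (VE * A) ≤ γ / 2 * VE + b ^ 2 / 2 * (A / γ) := by
    rw [Real.sqrt_mul hVE0]
    have h1 : A / γ = (Real.sqrt A / Real.sqrt γ) ^ 2 := by
      rw [div_pow, Real.sq_sqrt hA, Real.sq_sqrt hγpos.le]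
    have h2 := Real.sq_sqrt hVE0
    have h3 := Real.sq_sqrt hγpos.le
    have h4 := sq_nonneg (Real.sqrt γ * Real.sqrt VE - b * (Real.sqrt A / Real.sqrt γ))
    have h5 : Real.sqrt γ * (Real.sqrt A / Real.sqrt γ) = Real.sqrt A :=
      mul_div_cancel₀ _ (Real.sqrt_pos.2 hγpos).ne'
    rw [sub_sq, mul_pow, mul_pow, h2, h3, ← h1] at h4
    have h6 : Real.sqrt γ * Real.sqrt VE * (b * (Real.sqrt A / Real.sqrt γ)) =
        b * (Real.sqrt VE * Real.sqrt A) := by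
      rw [← congrArg (fun y => b * (Real.sqrt VE * y)) h5]; ring
    linarith
  have hlin : a * (G * D) * A ≤ a / 2 * (A / γ) := by
    have h1 : G * D ≤ 1 / 2 / γ := by rw [le_div_iff₀ hγpos]; linarith
    calc a * (G * D) * A ≤ a * (1 / 2 / γ) * A := by gcongr
      _ = a / 2 * (A / γ) := by ring
  have h7 := mul_le_mul_of_nonneg_left hsqrt hb
  linarith

theorem regret_le_of_forall (hne : X.Nonempty) {A : OnlineAlgorithm d} {B : ℝ}
    (h : ∀ u ∈ X, ∑ t ∈ Finset.range T, ((f t).val (A.play f t) - (f t).val u) ≤ B) :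
    A.regret X f T ≤ B := by
  rw [OnlineAlgorithm.regret, sub_le_comm]
  refine le_csInf (hne.image _) ?_
  rintro _ ⟨u, hu, rfl⟩
  have := h u hu
  rw [Finset.sum_sub_distrib] at this
  linarith

/-- In dimension zero `regretRate` vanishes, and all points coincide. -/
theorem regret_dim_zero {X : Set (Vec 0)} {f : ℕ → Loss 0} (hne : X.Nonempty)
    (A : OnlineAlgorithm 0) : A.regret X f T ≤ 0 :=
  regret_le_of_forall hne fun u _ => by
    simp [Subsingleton.elim u 0, Subsingleton.elim (A.play f _) 0]

theorem regretRate_nonneg (hG : 0 < G) (hD : 0 < D) (hα : 0 < α) :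
    0 ≤ regretRate d T k G D α := by
  have := gammaConst_pos hG hD hα
  have := Real.log_natCast_nonneg T
  rw [regretRate]
  positivity

/-- The regret bound common to MetaGrad and Maler. The second-order bound has `a = 10`, `b = 3` and
`A = 10 d log T`, which makes the coefficient of `d / γ * log T` equal to `(a + b ^ 2) / 2 * 10`. -/
theorem regret_le_of_surrogate_le (hT : 2 ≤ T) (hα : 0 < α)
    (hI : IsOCOInstance X G D T f) (hcont : IsContaminated (IsExpConcave α X) k T f)
    {A : OnlineAlgorithm d} (hplay : ∀ t, A.play f t ∈ X)
    (h : 0 < d → ∀ u ∈ X, ∀ i ≤ gridTop T,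
      rate G D i * ∑ t ∈ Finset.range T, inner ℝ ((f t).grad (A.play f t)) (A.play f t - u) -
        rate G D i ^ 2 * ∑ t ∈ Finset.range T,
          (inner ℝ ((f t).grad (A.play f t)) (A.play f t - u)) ^ 2 ≤ 10 * (d * Real.log T)) :
    A.regret X f T ≤ 95 * regretRate d T k G D α := by
  have hG := hI.G_pos
  have hD := hI.D_pos
  rcases d.eq_zero_or_pos with rfl | hd
  · exact (regret_dim_zero hI.nonempty A).trans
      (mul_nonneg (by norm_num) (regretRate_nonneg hG hD hα))
  refine regret_le_of_forall hI.nonempty fun u hu => ?_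
  have hlog := one_le_two_mul_log hT
  have hd1 : (1 : ℝ) ≤ d := by exact_mod_cast hd
  have hdlog : Real.log T ≤ d * Real.log T := le_mul_of_one_le_left (by linarith) hd1
  have hV : ∑ t ∈ Finset.range T, (inner ℝ ((f t).grad (A.play f t)) (A.play f t - u)) ^ 2 ≤
      T * (G * D) ^ 2 := by
    refine (Finset.sum_le_card_nsmul _ _ ((G * D) ^ 2) fun t ht => ?_).trans_eq (by simp)
    rw [sq_le_sq]
    exact (hI.abs_inner_le (Finset.mem_range.1 ht) (hplay t) (hplay t) hu).trans (le_abs_self _)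
  have hso := le_sqrt_of_forall_rate hG hD (by omega) (by linarith)
    (Finset.sum_nonneg fun _ _ => sq_nonneg _) hV (h hd u hu)
  refine (sum_sub_le_of_second_order hI hα hcont (fun t _ => hplay t) (fun _ _ => hu)
    (by norm_num) (by norm_num) (by linarith) hso).trans ?_
  have h1 : Real.sqrt (k * (10 * (d * Real.log T))) ≤ 4 * Real.sqrt (k * d * Real.log T) := by
    rw [show (4 : ℝ) = Real.sqrt (4 ^ 2) by rw [Real.sqrt_sq (by norm_num)],
      ← Real.sqrt_mul (by norm_num)]
    apply Real.sqrt_le_sqrt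
    have : 0 ≤ k * (d * Real.log T) := mul_nonneg k.cast_nonneg (by linarith)
    linarith
  have h2 : 3 * (G * D) * Real.sqrt (k * (10 * (d * Real.log T))) ≤
      3 * (G * D) * (4 * Real.sqrt (k * d * Real.log T)) := by gcongr
  have h3 : 10 * (d * Real.log T) / gammaConst G D α =
      10 * (d / gammaConst G D α * Real.log T) := by ring
  have h4 : 0 ≤ G * D * Real.sqrt (k * d * Real.log T) := by positivity
  rw [regretRate, h3]
  linarith

theorem metaGrad_regret_le {x₁ : Vec d} (hT : 2 ≤ T) (hα : 0 < α) (hI : IsOCOInstance X G D T f)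
    (hx₁ : x₁ ∈ X) (hcont : IsContaminated (IsExpConcave α X) k T f) :
    (metaGrad X G D T x₁).regret X f T ≤ 95 * regretRate d T k G D α :=
  regret_le_of_surrogate_le hT hα hI hcont (metaGrad_play_mem hI hx₁)
    fun hd _ hu _ hi => metaGrad_surrogate_le hd hT hI hx₁ hu hi

theorem maler_regret_le {x₁ : Vec d} (hT : 2 ≤ T) (hα : 0 < α) (hI : IsOCOInstance X G D T f)
    (hx₁ : x₁ ∈ X) (hcont : IsContaminated (IsExpConcave α X) k T f) :
    (maler X G D T x₁).regret X f T ≤ 95 * regretRate d T k G D α :=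
  regret_le_of_surrogate_le hT hα hI hcont (maler_play_mem hT hI hx₁)
    fun hd _ hu _ hi => maler_surrogate_le hd hT hI hx₁ hu hi

end Contaminated

/-! ### The Adapt-ML-Prod learning rate -/

section Rate

variable {N : ℕ} {S S' : ℝ}

theorem half_le_log_natCast (hN : 2 ≤ N) : 1 / 2 ≤ Real.log N := by
  linarith [one_le_two_mul_log hN]

theorem uscRate_pos (hN : 2 ≤ N) (hS : 0 ≤ S) : 0 < uscRate N S := by
  have := half_le_log_natCast hN
  exact lt_min (by norm_num) (Real.sqrt_pos.2 (div_pos (by linarith) (by linarith)))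

theorem uscRate_le_half : uscRate N S ≤ 1 / 2 := min_le_left _ _

theorem uscRate_zero (hN : 2 ≤ N) : uscRate N 0 = 1 / 2 := by
  refine min_eq_left (Real.le_sqrt_of_sq_le ?_)
  rw [add_zero, div_one]
  linarith [half_le_log_natCast hN]

theorem uscRate_anti (hN : 2 ≤ N) (hS : 0 ≤ S) (h : S ≤ S') : uscRate N S' ≤ uscRate N S := by
  have := half_le_log_natCast hN
  refine min_le_min le_rfl (Real.sqrt_le_sqrt ?_)
  exact div_le_div_of_nonneg_left (by linarith) (by linarith) (by linarith)

/-- Truncation at `1 / 2` does not make the learning rate decay faster. -/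
theorem sqrt_div_le_uscRate_div (hN : 2 ≤ N) (hS : 0 ≤ S) (h : S ≤ S') :
    Real.sqrt ((1 + S) / (1 + S')) ≤ uscRate N S' / uscRate N S := by
  have hlog := half_le_log_natCast hN
  rw [le_div_iff₀ (uscRate_pos hN hS)]
  refine le_min ?_ ?_
  · have h1 : Real.sqrt ((1 + S) / (1 + S')) ≤ 1 := by
      rw [Real.sqrt_le_iff, one_pow, div_le_one (by linarith)]
      refine ⟨zero_le_one, ?_⟩
      linarith
    exact (mul_le_of_le_one_left (uscRate_pos hN hS).le h1).trans uscRate_le_half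
  · refine (mul_le_mul_of_nonneg_left (min_le_right _ _) (Real.sqrt_nonneg _)).trans_eq ?_
    rw [← Real.sqrt_mul (div_nonneg (by linarith) (by linarith))]
    congr 1
    have h1 : 1 + S ≠ 0 := by linarith
    have h2 : 1 + S' ≠ 0 := by linarith
    field_simp

theorem inv_uscRate_le (hN : 2 ≤ N) (hS : 0 ≤ S) :
    (uscRate N S)⁻¹ ≤ 2 + Real.sqrt (1 + S) / Real.sqrt (Real.log N) := by
  have hlog := half_le_log_natCast hN
  have hnn : 0 ≤ Real.sqrt (1 + S) / Real.sqrt (Real.log N) := by positivity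
  rcases min_cases (1 / 2 : ℝ) (Real.sqrt (Real.log N / (1 + S))) with ⟨h, _⟩ | ⟨h, _⟩
  · rw [uscRate, h]; norm_num; exact hnn
  · rw [uscRate, h, Real.sqrt_div (by linarith), inv_div]; linarith

end Rate

/-! ### Adapt-ML-Prod -/

/-- One step of the power-corrected multiplicative update: the correction by the exponent
`uscRate N S' / uscRate N S ≤ 1` costs at most a telescoping logarithm. -/
theorem rpow_uscRate_div_le {N : ℕ} {S S' y : ℝ} (hN : 2 ≤ N) (hS : 0 ≤ S) (h : S ≤ S')
    (hy : 0 ≤ y) :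
    y ^ (uscRate N S' / uscRate N S) ≤
      y + (Real.log (1 + S') - Real.log (1 + S)) / 2 := by
  set θ := uscRate N S' / uscRate N S
  have hθ0 : 0 ≤ θ := div_nonneg (uscRate_pos hN (hS.trans h)).le (uscRate_pos hN hS).le
  have hθ1 : θ ≤ 1 := (div_le_one (uscRate_pos hN hS)).2 (uscRate_anti hN hS h)
  have h1 := rpow_one_add_le_one_add_mul_self (s := y - 1) (by linarith) hθ0 hθ1
  rw [add_sub_cancel] at h1
  have hx : 0 < (1 + S) / (1 + S') := div_pos (by linarith) (by linarith)
  have h2 := Real.log_le_sub_one_of_pos (Real.sqrt_pos.2 hx)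
  rw [Real.log_sqrt hx.le, Real.log_div (by linarith) (by linarith)] at h2
  have h3 := sqrt_div_le_uscRate_div hN hS h
  have h4 : 0 ≤ (1 - θ) * y := mul_nonneg (by linarith) hy
  linarith

/-- The telescoping bound behind `∑ r ^ 2 / √(1 + ∑ r ^ 2) ≤ 3 √(1 + ∑ r ^ 2)`; the denominator
does not contain the current term. -/
theorem sq_div_sqrt_le {S r : ℝ} (hS : 0 ≤ S) (hr : r ^ 2 ≤ 1) :
    r ^ 2 / Real.sqrt (1 + S) ≤ 3 * (Real.sqrt (1 + (S + r ^ 2)) - Real.sqrt (1 + S)) := by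
  have ha : 0 < Real.sqrt (1 + S) := Real.sqrt_pos.2 (by linarith)
  have ha2 : Real.sqrt (1 + S) ^ 2 = 1 + S := Real.sq_sqrt (by linarith)
  have hb2 : Real.sqrt (1 + (S + r ^ 2)) ^ 2 = 1 + (S + r ^ 2) := Real.sq_sqrt (by positivity)
  set a := Real.sqrt (1 + S)
  set b := Real.sqrt (1 + (S + r ^ 2))
  have hab : a ≤ b := Real.sqrt_le_sqrt (by linarith [sq_nonneg r])
  have hb : b ≤ 2 * a := by
    rw [← sq_le_sq₀ (by positivity) (by positivity)]
    linarith
  rw [div_le_iff₀ ha]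
  have h1 : r ^ 2 = (b - a) * (b + a) := by linarith
  have h2 : 0 ≤ (b - a) * (2 * a - b) := mul_nonneg (by linarith) (by linarith)
  linarith

/-- The second-order regret bound of Adapt-ML-Prod, for weights `w`, instantaneous regrets `r` and
learning rates `uscRate N (q t i)`. -/
theorem adaptMLProd_regret {N T : ℕ} (hN : 2 ≤ N) {w q r : ℕ → Fin N → ℝ}
    (hw0 : ∀ i, w 0 i = 1 / N) (hq0 : ∀ i, q 0 i = 0) (hpos : ∀ t ≤ T, ∀ i, 0 < w t i)
    (hq : ∀ t i, q (t + 1) i = q t i + r t i ^ 2)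
    (hw : ∀ t i, w (t + 1) i = (w t i * (1 + uscRate N (q t i) * r t i)) ^
      (uscRate N (q (t + 1) i) / uscRate N (q t i)))
    (hr : ∀ t < T, ∀ i, |r t i| ≤ 1)
    (hzero : ∀ t < T, ∑ i, uscRate N (q t i) * w t i * r t i = 0) (j : Fin N) :
    ∑ t ∈ Finset.range T, r t j ≤ 2 * Real.log N +
      Real.log (1 + N / 2 * Real.log (1 + T)) *
        (2 + Real.sqrt (1 + q T j) / Real.sqrt (Real.log N)) +
      3 * Real.sqrt (Real.log N) * Real.sqrt (1 + q T j) := by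
  have hlogN := half_le_log_natCast hN
  have hNpos : (0 : ℝ) < N := by exact_mod_cast (by omega : 0 < N)
  have hqnn : ∀ t i, 0 ≤ q t i := by
    intro t i
    induction t with
    | zero => rw [hq0]
    | succ t ih => rw [hq]; positivity
  have hqmono : ∀ t i, q t i ≤ q (t + 1) i := fun t i => by rw [hq]; linarith [sq_nonneg (r t i)]
  have hr2 : ∀ t < T, ∀ i, r t i ^ 2 ≤ 1 := fun t ht i => by
    rw [sq_le_one_iff_abs_le_one]; exact hr t ht i
  have hqle : ∀ t ≤ T, ∀ i, q t i ≤ t := by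
    intro t
    induction t with
    | zero => intro _ i; simp [hq0]
    | succ t ih =>
      intro ht i
      rw [hq]; push_cast
      linarith [ih (by omega) i, hr2 t (by omega) i]
  have hprod : ∀ t < T, ∀ i, -(1 / 2) ≤ uscRate N (q t i) * r t i := by
    intro t ht i
    have h1 : |uscRate N (q t i) * r t i| ≤ 1 / 2 * 1 := by
      rw [abs_mul, abs_of_pos (uscRate_pos hN (hqnn t i))]
      exact mul_le_mul uscRate_le_half (hr t ht i) (abs_nonneg _) (by norm_num)
    linarith [(abs_le.1 h1).1]
  -- The total weight grows only through the changes of the learning rates.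
  have hupper : ∀ n ≤ T, ∑ i, w n i ≤ 1 + ∑ i, Real.log (1 + q n i) / 2 := by
    intro n
    induction n with
    | zero => intro _; simp [hw0, hq0, hNpos.ne']
    | succ n ih =>
      intro hn
      have h1 : ∀ i, w (n + 1) i ≤ w n i + uscRate N (q n i) * w n i * r n i +
          (Real.log (1 + q (n + 1) i) / 2 - Real.log (1 + q n i) / 2) := by
        intro i
        have h2 : 0 ≤ w n i * (1 + uscRate N (q n i) * r n i) :=
          mul_nonneg (hpos n (by omega) i).le (by linarith [hprod n (by omega) i])
        have h3 := rpow_uscRate_div_le hN (hqnn n i) (hqmono n i) h2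
        rw [hw]
        linarith
      have h4 := Finset.sum_le_sum fun i (_ : i ∈ Finset.univ) => h1 i
      rw [Finset.sum_add_distrib, Finset.sum_add_distrib, Finset.sum_sub_distrib,
        hzero n (by omega)] at h4
      linarith [ih (by omega)]
  -- Dividing the logarithm of a weight by its learning rate undoes the power correction.
  have hlower : ∀ n ≤ T, -(2 * Real.log N) + ∑ t ∈ Finset.range n, r t j -
      3 * Real.sqrt (Real.log N) * Real.sqrt (1 + q n j) ≤
      Real.log (w n j) / uscRate N (q n j) := by
    intro n
    induction n with
    | zero =>
      intro _
      rw [hw0, hq0, uscRate_zero hN, one_div (N : ℝ), Real.log_inv]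
      simp
      linarith [Real.sqrt_nonneg (Real.log N)]
    | succ n ih =>
      intro hn
      have hη := uscRate_pos hN (hqnn n j)
      have hη' := uscRate_pos hN (hqnn (n + 1) j)
      have hz := hprod n (by omega) j
      have hone : 0 < 1 + uscRate N (q n j) * r n j := by linarith
      have h1 : Real.log (w (n + 1) j) / uscRate N (q (n + 1) j) =
          Real.log (w n j) / uscRate N (q n j) +
            Real.log (1 + uscRate N (q n j) * r n j) / uscRate N (q n j) := by
        rw [hw, Real.log_rpow (mul_pos (hpos n (by omega) j) hone),
          Real.log_mul (hpos n (by omega) j).ne' hone.ne']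
        field_simp
      have h2 : r n j - uscRate N (q n j) * r n j ^ 2 ≤
          Real.log (1 + uscRate N (q n j) * r n j) / uscRate N (q n j) := by
        rw [le_div_iff₀ hη]
        refine le_trans (le_of_eq (by ring)) ((Real.le_log_iff_exp_le hone).2
          (exp_sub_sq_le_one_add hz))
      have h3 : uscRate N (q n j) * r n j ^ 2 ≤ 3 * Real.sqrt (Real.log N) *
          (Real.sqrt (1 + q (n + 1) j) - Real.sqrt (1 + q n j)) := by
        have h4 : uscRate N (q n j) ≤ Real.sqrt (Real.log N) / Real.sqrt (1 + q n j) := by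
          rw [← Real.sqrt_div (by linarith)]
          exact min_le_right _ _
        rw [hq]
        calc uscRate N (q n j) * r n j ^ 2
            ≤ Real.sqrt (Real.log N) / Real.sqrt (1 + q n j) * r n j ^ 2 := by gcongr
          _ = Real.sqrt (Real.log N) * (r n j ^ 2 / Real.sqrt (1 + q n j)) := by ring
          _ ≤ Real.sqrt (Real.log N) *
              (3 * (Real.sqrt (1 + (q n j + r n j ^ 2)) - Real.sqrt (1 + q n j))) :=
            mul_le_mul_of_nonneg_left (sq_div_sqrt_le (hqnn n j) (hr2 n (by omega) j))
              (Real.sqrt_nonneg _)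
          _ = _ := by ring
      rw [Finset.sum_range_succ, h1]
      linarith [ih (by omega)]
  have hlogT : 0 ≤ Real.log (1 + T) := Real.log_nonneg (by linarith [T.cast_nonneg (α := ℝ)])
  have htotal : w T j ≤ 1 + N / 2 * Real.log (1 + T) := by
    have h1 : ∑ i, Real.log (1 + q T i) / 2 ≤ N / 2 * Real.log (1 + T) := by
      refine (Finset.sum_le_card_nsmul _ _ (Real.log (1 + T) / 2) fun i _ => ?_).trans_eq ?_
      · have := Real.log_le_log (by linarith [hqnn T i]) (add_le_add_right (hqle T le_rfl i) 1)
        linarith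
      · rw [Finset.card_univ, Fintype.card_fin, nsmul_eq_mul]; ring
    exact (Finset.single_le_sum (fun i _ => (hpos T le_rfl i).le) (Finset.mem_univ j)).trans
      ((hupper T le_rfl).trans (by linarith))
  have hη := uscRate_pos hN (hqnn T j)
  have hfinal : Real.log (w T j) / uscRate N (q T j) ≤
      Real.log (1 + N / 2 * Real.log (1 + T)) *
        (2 + Real.sqrt (1 + q T j) / Real.sqrt (Real.log N)) := by
    rw [div_eq_mul_inv]
    refine mul_le_mul (Real.log_le_log (hpos T le_rfl j) htotal) (inv_uscRate_le hN (hqnn T j))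
      (inv_nonneg.2 hη.le) (Real.log_nonneg ?_)
    have : 0 ≤ N / 2 * Real.log (1 + T) := by positivity
    linarith
  linarith [hlower T le_rfl]

/-! ### USC -/

section USC

variable {d N T k : ℕ} {X : Set (Vec d)} {G D α : ℝ} {f : ℕ → Loss d}
  {A : Fin N → OnlineAlgorithm d}

/-- The prediction of the expert `i`. -/
def USCState.prediction (s : USCState A) (i : Fin N) : Vec d := (A i).action (s.expert i)

/-- The instantaneous regret `r^i` towards the expert `i` when the gradient `g` is revealed. -/
noncomputable def USCState.excess (G D : ℝ) (s : USCState A) (g : Vec d) (i : Fin N) : ℝ :=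
  (∑ j, s.prob j * ((inner ℝ g (s.prediction j - s.action) + G * D) / (2 * G * D))) -
    (inner ℝ g (s.prediction i - s.action) + G * D) / (2 * G * D)

/-- The weights are positive and the sums of squares nonnegative. -/
def USCState.Valid (s : USCState A) : Prop := (∀ i, 0 < s.weight i) ∧ ∀ i, 0 ≤ s.sq i

theorem USCState.Valid.prob_pos (hN : 2 ≤ N) {s : USCState A} (hs : s.Valid) (i : Fin N) :
    0 < s.prob i :=
  div_pos (mul_pos (uscRate_pos hN (hs.2 i)) (hs.1 i))
    (Finset.sum_pos (fun j _ => mul_pos (uscRate_pos hN (hs.2 j)) (hs.1 j)) ⟨i, Finset.mem_univ i⟩)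

theorem USCState.Valid.sum_prob (hN : 2 ≤ N) {s : USCState A} (hs : s.Valid) :
    ∑ i, s.prob i = 1 := by
  have h : 0 < ∑ j, uscRate N (s.sq j) * s.weight j :=
    Finset.sum_pos (fun j _ => mul_pos (uscRate_pos hN (hs.2 j)) (hs.1 j))
      ⟨⟨0, by omega⟩, Finset.mem_univ _⟩
  simp only [USCState.prob, ← Finset.sum_div]
  exact div_self h.ne'

theorem USCState.Valid.action_mem (hN : 2 ≤ N) (hconv : Convex ℝ X) {s : USCState A}
    (hs : s.Valid) (h : ∀ i, s.prediction i ∈ X) : s.action ∈ X :=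
  hconv.sum_mem (fun i _ => (hs.prob_pos hN i).le) (hs.sum_prob hN) fun i _ => h i

theorem USCState.Valid.sum_prob_mul_inner (hN : 2 ≤ N) {s : USCState A} (hs : s.Valid)
    (g : Vec d) : ∑ i, s.prob i * inner ℝ g (s.prediction i - s.action) = 0 := by
  have h1 : ∑ i, s.prob i • (s.prediction i - s.action) = 0 := by
    simp only [smul_sub, Finset.sum_sub_distrib, ← Finset.sum_smul, hs.sum_prob hN, one_smul]
    exact sub_self _
  have h2 := congrArg (fun y => (inner ℝ g y : ℝ)) h1
  simpa [inner_sum, inner_smul_right] using h2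

theorem USCState.Valid.excess_eq (hN : 2 ≤ N) {s : USCState A}
    (hs : s.Valid) (g : Vec d) (i : Fin N) :
    s.excess G D g i = inner ℝ g (s.action - s.prediction i) / (2 * G * D) := by
  have h : ∑ j, s.prob j * ((inner ℝ g (s.prediction j - s.action) + G * D) / (2 * G * D)) =
      G * D / (2 * G * D) := by
    simp only [mul_div_assoc', ← Finset.sum_div, mul_add, Finset.sum_add_distrib,
      hs.sum_prob_mul_inner hN, ← Finset.sum_mul, hs.sum_prob hN]
    ring
  rw [USCState.excess, h, ← neg_sub (s.prediction i), inner_neg_right]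
  ring

theorem USCState.Valid.sum_mul_excess (hN : 2 ≤ N) (hG : 0 < G) (hD : 0 < D) {s : USCState A}
    (hs : s.Valid) (g : Vec d) :
    ∑ i, uscRate N (s.sq i) * s.weight i * s.excess G D g i = 0 := by
  have h : 0 < ∑ j, uscRate N (s.sq j) * s.weight j :=
    Finset.sum_pos (fun j _ => mul_pos (uscRate_pos hN (hs.2 j)) (hs.1 j))
      ⟨⟨0, by omega⟩, Finset.mem_univ _⟩
  have h1 : ∀ i, uscRate N (s.sq i) * s.weight i * s.excess G D g i =
      -((∑ j, uscRate N (s.sq j) * s.weight j) / (2 * G * D)) *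
        (s.prob i * inner ℝ g (s.prediction i - s.action)) := by
    intro i
    rw [hs.excess_eq hN, ← neg_sub (s.prediction i), inner_neg_right, USCState.prob]
    field_simp
  simp only [h1, ← Finset.mul_sum, hs.sum_prob_mul_inner hN, mul_zero]

theorem usc_expert (t : ℕ) (i : Fin N) :
    USCState.expert ((usc G D A).stateAt f t) i = (A i).stateAt f t := by
  induction t with
  | zero => rfl
  | succ t ih =>
    show (A i).update (USCState.expert ((usc G D A).stateAt f t) i) (f t) = _
    rw [ih]
    rfl

theorem usc_prediction (t : ℕ) (i : Fin N) :
    USCState.prediction ((usc G D A).stateAt f t) i = (A i).play f t := by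
  exact congrArg (A i).action (usc_expert t i)

theorem abs_excess_le (hN : 2 ≤ N) (hI : IsOCOInstance X G D T f) {t : ℕ} (ht : t < T)
    {s : USCState A} (hs : s.Valid) (h : ∀ i, s.prediction i ∈ X) (i : Fin N) :
    |s.excess G D ((f t).grad s.action) i| ≤ 1 := by
  have hG := hI.G_pos
  have hD := hI.D_pos
  have hx := hs.action_mem hN hI.convex h
  have h1 := hI.abs_inner_le ht hx hx (h i)
  have hGD : 0 < G * D := mul_pos hG hD
  rw [hs.excess_eq hN, abs_div, abs_of_pos (by positivity : 0 < 2 * G * D),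
    div_le_one (by positivity)]
  linarith

theorem usc_valid (hN : 2 ≤ N) (hI : IsOCOInstance X G D T f)
    (hplay : ∀ i, ∀ t < T, (A i).play f t ∈ X) :
    ∀ t ≤ T, USCState.Valid ((usc G D A).stateAt f t) := by
  intro t
  induction t with
  | zero =>
    intro _
    have hNpos : (0 : ℝ) < N := by exact_mod_cast (by omega : 0 < N)
    exact ⟨fun _ => one_div_pos.2 hNpos, fun _ => le_rfl⟩
  | succ t ih =>
    intro ht
    have hs := ih (by omega)
    have hpred : ∀ i, USCState.prediction ((usc G D A).stateAt f t) i ∈ X := fun i => by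
      rw [usc_prediction]; exact hplay i t (by omega)
    refine ⟨fun i => Real.rpow_pos_of_pos (mul_pos (hs.1 i) ?_) _,
      fun i => add_nonneg (hs.2 i) (sq_nonneg _)⟩
    have h1 := abs_excess_le hN hI (by omega : t < T) hs hpred i
    set s : USCState A := (usc G D A).stateAt f t
    have h2 : |uscRate N (s.sq i) * s.excess G D ((f t).grad s.action) i| ≤ 1 / 2 * 1 := by
      rw [abs_mul, abs_of_pos (uscRate_pos hN (hs.2 i))]
      exact mul_le_mul uscRate_le_half h1 (abs_nonneg _) (by norm_num)
    have h3 : 0 < 1 + uscRate N (s.sq i) * s.excess G D ((f t).grad s.action) i := by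
      linarith [(abs_le.1 h2).1]
    exact h3

theorem usc_play_mem (hN : 2 ≤ N) (hI : IsOCOInstance X G D T f)
    (hplay : ∀ i, ∀ t < T, (A i).play f t ∈ X) {t : ℕ} (ht : t < T) :
    (usc G D A).play f t ∈ X :=
  (usc_valid hN hI hplay t ht.le).action_mem hN hI.convex fun i => by
    rw [usc_prediction]; exact hplay i t ht

/-- The regret bound of Adapt-ML-Prod in terms of the linearized losses; `S` is the sum of the
squared instantaneous regrets towards the expert `j`. -/
theorem usc_linearized_regret (hN : 2 ≤ N) (hI : IsOCOInstance X G D T f)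
    (hplay : ∀ i, ∀ t < T, (A i).play f t ∈ X) (j : Fin N) :
    ∃ S : ℝ, 0 ≤ S ∧
      (2 * G * D) ^ 2 * S = ∑ t ∈ Finset.range T, (inner ℝ ((f t).grad ((usc G D A).play f t))
        ((usc G D A).play f t - (A j).play f t)) ^ 2 ∧
      ∑ t ∈ Finset.range T, inner ℝ ((f t).grad ((usc G D A).play f t))
        ((usc G D A).play f t - (A j).play f t) ≤ 2 * G * D * (2 * Real.log N +
          Real.log (1 + N / 2 * Real.log (1 + T)) *
            (2 + Real.sqrt (1 + S) / Real.sqrt (Real.log N)) +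
          3 * Real.sqrt (Real.log N) * Real.sqrt (1 + S)) := by
  have hG := hI.G_pos
  have hD := hI.D_pos
  have hvalid := usc_valid hN hI hplay
  set s : ℕ → USCState A := (usc G D A).stateAt f with hs
  set r : ℕ → Fin N → ℝ := fun t => (s t).excess G D ((f t).grad (s t).action) with hr
  have hsucc : ∀ t i, (s (t + 1)).sq i = (s t).sq i + r t i ^ 2 := fun _ _ => rfl
  have hreg := adaptMLProd_regret (T := T) hN (w := fun t => (s t).weight)
    (q := fun t => (s t).sq) (r := r) (fun _ => rfl) (fun _ => rfl) (fun t ht => (hvalid t ht).1)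
    hsucc (fun _ _ => rfl)
    (fun t ht i => abs_excess_le hN hI ht (hvalid t ht.le)
      (fun i => by rw [usc_prediction]; exact hplay i t ht) i)
    (fun t ht => (hvalid t ht.le).sum_mul_excess hN hG hD _) j
  have hr_eq : ∀ t ∈ Finset.range T, inner ℝ ((f t).grad ((usc G D A).play f t))
      ((usc G D A).play f t - (A j).play f t) = 2 * G * D * r t j := by
    intro t ht
    have h1 : r t j = _ := (hvalid t (Finset.mem_range.1 ht).le).excess_eq hN
      ((f t).grad (s t).action) j
    rw [h1, hs, usc_prediction]
    have h2 : USCState.action ((usc G D A).stateAt f t) = (usc G D A).play f t := rfl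
    rw [h2]
    field_simp
  have hsq : ∀ n, (s n).sq j = ∑ t ∈ Finset.range n, r t j ^ 2 := by
    intro n
    induction n with
    | zero => rfl
    | succ n ih => rw [Finset.sum_range_succ, hsucc, ih]
  refine ⟨(s T).sq j, (hvalid T le_rfl).2 j, ?_, ?_⟩
  · rw [hsq, Finset.mul_sum]
    refine Finset.sum_congr rfl fun t ht => ?_
    rw [hr_eq t ht, mul_pow (2 * G * D)]
  · rw [Finset.sum_congr rfl hr_eq, ← Finset.mul_sum]
    exact mul_le_mul_of_nonneg_left hreg (by positivity)

/-- With at most `c log T` experts, all logarithmic terms of the Adapt-ML-Prod bound are of order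
`log T`. In particular `log (1 + N log T)` is of order `√(log T)`. -/
theorem adaptMLProd_bound_le {c S : ℝ} (hc : 0 < c) (hT : 2 ≤ T) (hN : 2 ≤ N)
    (hNT : (N : ℝ) ≤ c * Real.log T) (hS : 0 ≤ S) :
    2 * Real.log N + Real.log (1 + N / 2 * Real.log (1 + T)) *
        (2 + Real.sqrt (1 + S) / Real.sqrt (Real.log N)) +
      3 * Real.sqrt (Real.log N) * Real.sqrt (1 + S) ≤
    (24 * c + 38) * Real.log T + (7 * c + 11) * Real.sqrt (S * Real.log T) := by
  have hx := one_le_two_mul_log hT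
  have hlogN := half_le_log_natCast hN
  set x := Real.log T with hxdef
  have hNpos : (0 : ℝ) < N := by exact_mod_cast (by omega : 0 < N)
  have hlogNx : Real.log N ≤ c * x := (Real.log_le_self hNpos.le).trans hNT
  set y := Real.sqrt x with hydef
  have hy2 : y ^ 2 = x := Real.sq_sqrt (by linarith)
  have hyhalf : 1 / 2 ≤ y := Real.le_sqrt_of_sq_le (by linarith)
  have hyx : y ≤ 2 * x := by nlinarith
  have hL : Real.log (1 + N / 2 * Real.log (1 + T)) ≤ (2 * c + 4) * y := by
    have h1 : N / 2 * Real.log (1 + T) ≤ c * x * x := by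
      have h2 : (N : ℝ) / 2 * Real.log (1 + T) ≤ N / 2 * (2 * x) :=
        mul_le_mul_of_nonneg_left (log_one_add_le_two_mul hT) (by positivity)
      have h3 := mul_le_mul_of_nonneg_right hNT (by linarith : 0 ≤ x)
      linarith
    have h4 : 0 ≤ N / 2 * Real.log (1 + T) :=
      mul_nonneg (by positivity) (Real.log_nonneg (by linarith [T.cast_nonneg (α := ℝ)]))
    have h5 : 1 + N / 2 * Real.log (1 + T) ≤ (1 + c) * (1 + x) ^ 2 := by
      nlinarith [mul_nonneg hc.le (by linarith : 0 ≤ x)]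
    have h6 := Real.log_le_log (by linarith) h5
    rw [Real.log_mul (by positivity) (by positivity), Real.log_pow] at h6
    have h7 : Real.log (1 + c) ≤ c := by linarith [Real.log_le_sub_one_of_pos (by linarith : 0 < 1 + c)]
    have h8 : Real.log (1 + x) ≤ 2 * y := by
      have h9 : Real.log ((1 + y) ^ 2) = 2 * Real.log (1 + y) := by rw [Real.log_pow]; norm_num
      have h10 : Real.log (1 + x) ≤ Real.log ((1 + y) ^ 2) :=
        Real.log_le_log (by linarith) (by nlinarith)
      linarith [Real.log_le_sub_one_of_pos (by linarith : 0 < 1 + y)]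
    push_cast at h6
    nlinarith
  have hsqrtS : Real.sqrt (1 + S) ≤ 1 + Real.sqrt S := by
    have := sqrt_add_le_sqrt_add_sqrt zero_le_one hS
    rwa [Real.sqrt_one] at this
  have hsqrtN : Real.sqrt (Real.log N) ≤ (1 + c) * y := by
    rw [Real.sqrt_le_left (by positivity), mul_pow, hy2]
    nlinarith
  have hinv : Real.sqrt (1 + S) / Real.sqrt (Real.log N) ≤ 2 * (1 + Real.sqrt S) := by
    have h1 : 1 / 2 ≤ Real.sqrt (Real.log N) := Real.le_sqrt_of_sq_le (by linarith)
    rw [div_le_iff₀ (by linarith)]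
    have h2 : 0 ≤ 1 + Real.sqrt S := by positivity
    nlinarith
  have hterm1 : Real.log (1 + N / 2 * Real.log (1 + T)) *
      (2 + Real.sqrt (1 + S) / Real.sqrt (Real.log N)) ≤
      (2 * c + 4) * y * (2 + 2 * (1 + Real.sqrt S)) :=
    mul_le_mul hL (by linarith) (by positivity) (by positivity)
  have hterm2 : 3 * Real.sqrt (Real.log N) * Real.sqrt (1 + S) ≤
      3 * ((1 + c) * y) * (1 + Real.sqrt S) := by gcongr
  have hsplit : Real.sqrt (S * x) = y * Real.sqrt S := by rw [Real.sqrt_mul hS, mul_comm]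
  rw [hsplit]
  have h1 : (11 * c + 19) * y ≤ (11 * c + 19) * (2 * x) :=
    mul_le_mul_of_nonneg_left hyx (by positivity)
  linarith

theorem usc_regret_le {c : ℝ} (hc : 0 < c) {x₁ : Vec d} (hT : 2 ≤ T) (hα : 0 < α)
    (hI : IsOCOInstance X G D T f) (hx₁ : x₁ ∈ X)
    (hcont : IsContaminated (IsExpConcave α X) k T f) (hN : 2 ≤ N)
    (hNT : (N : ℝ) ≤ c * Real.log T) (hplay : ∀ i, ∀ t < T, (A i).play f t ∈ X)
    (hA : ∃ i, A i = metaGrad X G D T x₁ ∨ A i = maler X G D T x₁) :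
    (usc G D A).regret X f T ≤
      ((2 * (24 * c + 38) + (7 * c + 11) ^ 2) / 2 + (7 * c + 11) + 95) *
        regretRate d T k G D α := by
  have hG := hI.G_pos
  have hD := hI.D_pos
  have hrate := regretRate_nonneg (d := d) (T := T) (k := k) hG hD hα
  rcases d.eq_zero_or_pos with rfl | hd
  · exact (regret_dim_zero hI.nonempty _).trans (mul_nonneg (by positivity) hrate)
  obtain ⟨j, hj⟩ := hA
  have hexpert : (A j).regret X f T ≤ 95 * regretRate d T k G D α := by
    rcases hj with hj | hj
    · rw [hj]; exact metaGrad_regret_le hT hα hI hx₁ hcont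
    · rw [hj]; exact maler_regret_le hT hα hI hx₁ hcont
  have hlog : 0 ≤ Real.log T := Real.log_natCast_nonneg T
  have hmeta : ∑ t ∈ Finset.range T,
      ((f t).val ((usc G D A).play f t) - (f t).val ((A j).play f t)) ≤
      (2 * (24 * c + 38) + (7 * c + 11) ^ 2) / 2 * (Real.log T / gammaConst G D α) +
        (7 * c + 11) * (G * D) * Real.sqrt (k * Real.log T) := by
    obtain ⟨S, hS0, hS, hle⟩ := usc_linearized_regret hN hI hplay j
    refine sum_sub_le_of_second_order hI hα hcont (fun t ht => usc_play_mem hN hI hplay ht)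
      (hplay j) (by positivity) (by positivity) hlog (hle.trans ?_)
    have h1 := mul_le_mul_of_nonneg_left (adaptMLProd_bound_le hc hT hN hNT hS0)
      (by positivity : 0 ≤ 2 * G * D)
    refine h1.trans_eq ?_
    rw [← hS, mul_assoc ((2 * G * D) ^ 2), Real.sqrt_mul (sq_nonneg _),
      Real.sqrt_sq (by positivity)]
    ring
  have hsplit : (usc G D A).regret X f T = ∑ t ∈ Finset.range T,
      ((f t).val ((usc G D A).play f t) - (f t).val ((A j).play f t)) + (A j).regret X f T := by
    rw [OnlineAlgorithm.regret, OnlineAlgorithm.regret, Finset.sum_sub_distrib]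
    ring
  have hd1 : (1 : ℝ) ≤ d := by exact_mod_cast hd
  have hγ := gammaConst_pos hG hD hα
  set P := (d : ℝ) / gammaConst G D α * Real.log T with hP
  set Q := G * D * Real.sqrt (k * d * Real.log T) with hQ
  have hPQ : regretRate d T k G D α = P + Q := rfl
  have hP0 : 0 ≤ P := by positivity
  have hQ0 : 0 ≤ Q := by positivity
  have h1 : Real.log T / gammaConst G D α ≤ P := by
    rw [hP, div_mul_eq_mul_div]
    gcongr
    exact le_mul_of_one_le_left hlog hd1
  have h2 : G * D * Real.sqrt (k * Real.log T) ≤ Q := by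
    rw [hQ, mul_assoc (k : ℝ)]
    gcongr
    exact le_mul_of_one_le_left hlog hd1
  have h3 : (2 * (24 * c + 38) + (7 * c + 11) ^ 2) / 2 * (Real.log T / gammaConst G D α) ≤
      (2 * (24 * c + 38) + (7 * c + 11) ^ 2) / 2 * P :=
    mul_le_mul_of_nonneg_left h1 (by positivity)
  have h4 : (7 * c + 11) * (G * D * Real.sqrt (k * Real.log T)) ≤ (7 * c + 11) * Q :=
    mul_le_mul_of_nonneg_left h2 (by positivity)
  have h5 : 0 ≤ (2 * (24 * c + 38) + (7 * c + 11) ^ 2) / 2 * Q := by positivity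
  have h6 : 0 ≤ (7 * c + 11) * P := by positivity
  rw [hPQ] at hexpert ⊢
  rw [hsplit]
  linarith

end USC

end ContaminatedOCO

/-- Regret of MetaGrad, Maler and USC on `k`-contaminated `α`-exp-concave losses. The constant of
the first part is absolute; that of the second part depends only on the constant `c` in the bound
`c log T` for the number of experts of USC. -/
theorem mainTheorem4 :
    (∃ C : ℝ, 0 < C ∧
      ∀ (d T k : ℕ) (G D α : ℝ) (X : Set (Vec d)) (f : ℕ → Loss d) (x₁ : Vec d),
        2 ≤ T → 0 < α → IsOCOInstance X G D T f → x₁ ∈ X →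
        IsContaminated (IsExpConcave α X) k T f →
          (metaGrad X G D T x₁).regret X f T ≤ C * regretRate d T k G D α ∧
          (maler X G D T x₁).regret X f T ≤ C * regretRate d T k G D α) ∧
    (∀ c : ℝ, 0 < c → ∃ C : ℝ, 0 < C ∧
      ∀ (d T k : ℕ) (G D α : ℝ) (X : Set (Vec d)) (f : ℕ → Loss d) (x₁ : Vec d)
        (N : ℕ) (A : Fin N → OnlineAlgorithm d),
        2 ≤ T → 0 < α → IsOCOInstance X G D T f → x₁ ∈ X →
        IsContaminated (IsExpConcave α X) k T f →
        2 ≤ N → (N : ℝ) ≤ c * Real.log T →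
        (∀ i, ∀ t < T, (A i).play f t ∈ X) →
        (∃ i, A i = metaGrad X G D T x₁ ∨ A i = maler X G D T x₁) →
          (usc G D A).regret X f T ≤ C * regretRate d T k G D α) := by
  refine ⟨⟨95, by norm_num, fun d T k G D α X f x₁ hT hα hI hx₁ hcont =>
    ⟨metaGrad_regret_le hT hα hI hx₁ hcont, maler_regret_le hT hα hI hx₁ hcont⟩⟩, fun c hc => ?_⟩
  exact ⟨(2 * (24 * c + 38) + (7 * c + 11) ^ 2) / 2 + (7 * c + 11) + 95, by positivity,
    fun d T k G D α X f x₁ N A hT hα hI hx₁ hcont hN hNT hplay hA =>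
      usc_regret_le hc hT hα hI hx₁ hcont hN hNT hplay hA⟩
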